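/- Let $\Gamma\subset\mathbb R^d$ ($d\ge 1$) be a bounded open set and $(\Omega,\mathbb F,\mathbb P)$ a probability space. Let $a=a(\omega,x)$ be a random conductivity such that almost surely $a(\omega,\cdot)$ is measurable and $0<a_{\min}(\omega)\le a(\omega,x)\le a_{\max}(\omega)<\infty$ for almost every $x\in\Gamma$, for bounds that may depend on $\omega$. Let $f=f(\omega,x)$ be a random source and $g=g(x)$ an observable, such that $f(\omega,\cdot)v$ (almost surely) and $gv$ are integrable on $\Gamma$ for every $v\in V:=H^1_0(\Gamma)$; for example, $f(\omega,\cdot),g\in L^2(\Gamma)$. Let $(\mathcal T_h)_{h\in M}$ be a shape-regular family of meshes in $\Gamma$, indexed by mesh sizes $h$ in a set $M\subset(0,\infty)$ with $h/2\in M$ whenever $h\in M$: each $\mathcal T_h$ is a finite conforming mesh of nondegenerate closed $d$-simplices contained in $\overline\Gamma$ (two simplices meet in a common face or not at all); there are constants $\kappa,\rho>0$, independent of $h$, such that every simplex $K\in\mathcal T_h$ has $\operatorname{diam}K\le\kappa h$ and contains a ball of radius $\rho\operatorname{diam}K$; and every compact subset of $\Gamma$ is covered by $\mathcal T_h$ for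 all sufficiently small $h\in M$ (this is automatic if every $\mathcal T_h$ covers $\Gamma$). Let $V_h$ be the space of continuous functions on $\mathbb R^d$ that are affine on every simplex of $\mathcal T_h$ and vanish outside $\Gamma$ and outside the union of the simplices of $\mathcal T_h$. Almost surely, let $u,\lambda\in V$ be the solutions of the primal and dual problems $$\int_\Gamma a\,\nabla u\cdot\nabla v\,dx=\int_\Gamma fv\,dx,\qquad \int_\Gamma a\,\nabla\lambda\cdot\nabla v\,dx=\int_\Gamma gv\,dx\qquad\text{for all }v\in V,$$ and, for every $h\in M$, let $u_h,\lambda_h\in V_h$ be their Galerkin approximations, which satisfy the same equations for all $v\in V_h$. Let $\mathcal E(g)=(g,u-u_h)=\int_\Gamma g\,(u-u_h)\,dx$ be the Galerkin error in the observable $g$. Assume that there are constants $\alpha,\beta>0$, a positive random variable $C=C(\omega)$ and a threshold $h_0=h_0(\omega)>0$ such that, almost surely, for all mesh sizes $h,H\in M$ with $h,H\le h_0$, $$\int_\Gamma a(x)\,\bigl|\nabla(u_{h/2}-u_h)(x)\cdot\nabla(\lambda_{H/2}-\lambda_H)(x)\bigr|\,dx\le C\,h^\alpha H^\beta .$$ Then,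 almost surely, for all $h\in M$ with $h\le h_0$, $$|\mathcal E(g)|\le\frac{C\,h^{\alpha+\beta}}{(1-2^{-\alpha})(1-2^{-\beta})}$$ with the same $C$. -/

import Mathlib

open MeasureTheory Set Filter Topology

noncomputable section

/-- The Euclidean space `ℝᵈ`. -/
abbrev Space (d : ℕ) : Type := EuclideanSpace ℝ (Fin d)

/-! ### Sobolev spaces on an open set -/

/-- `φ` is a test function on `Γ`: smooth, with compact support contained in `Γ`. -/
structure IsTestFunction {d : ℕ} (Γ : Set (Space d)) (φ : Space d → ℝ) : Prop where
  smooth : ContDiff ℝ (⊤ : ℕ∞) φ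
  compact : HasCompactSupport φ
  support : tsupport φ ⊆ Γ

/-- `G` is a weak (distributional) gradient of `v` on `Γ`. -/
structure HasWeakGradient {d : ℕ} (Γ : Set (Space d)) (v : Space d → ℝ)
    (G : Space d → Space d) : Prop where
  locInt_fun : LocallyIntegrableOn v Γ
  locInt_grad : LocallyIntegrableOn G Γ
  integral_eq : ∀ φ : Space d → ℝ, IsTestFunction Γ φ →
    ∫ x in Γ, v x • gradient φ x = -∫ x in Γ, φ x • G x

open Classical in
/-- The weak gradient of `v` on `Γ` (unique up to null sets), and `0` if there is none. -/
def weakGrad {d : ℕ} (Γ : Set (Space d)) (v : Space d → ℝ) : Space d → Space d :=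
  if h : ∃ G, HasWeakGradient Γ v G then h.choose else 0

/-- `v ∈ H¹(Γ)`. -/
structure MemH1 {d : ℕ} (Γ : Set (Space d)) (v : Space d → ℝ) : Prop where
  memLp_fun : MemLp v 2 (volume.restrict Γ)
  hasGrad : ∃ G, HasWeakGradient Γ v G
  memLp_grad : MemLp (weakGrad Γ v) 2 (volume.restrict Γ)

/-- `v ∈ H¹₀(Γ)`: `v` is a limit of test functions in the norm of `H¹(Γ)`. -/
def MemH10 {d : ℕ} (Γ : Set (Space d)) (v : Space d → ℝ) : Prop :=
  MemH1 Γ v ∧ ∃ φ : ℕ → Space d → ℝ, (∀ n, IsTestFunction Γ (φ n)) ∧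
    Tendsto (fun n => eLpNorm (fun x => v x - φ n x) 2 (volume.restrict Γ)) atTop (𝓝 0) ∧
    Tendsto (fun n => eLpNorm (fun x => weakGrad Γ v x - gradient (φ n) x) 2
      (volume.restrict Γ)) atTop (𝓝 0)

/-! ### The elliptic problem -/

/-- One path of the conductivity: measurable, and bounded above and away from zero on `Γ`. -/
def IsConductivity {d : ℕ} (Γ : Set (Space d)) (a : Space d → ℝ) : Prop :=
  AEStronglyMeasurable a (volume.restrict Γ) ∧
    ∃ amin amax : ℝ, 0 < amin ∧ ∀ᵐ x ∂(volume.restrict Γ), amin ≤ a x ∧ a x ≤ amax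

/-- An admissible source: `∫_Γ f v` is an absolutely convergent integral for all `v ∈ H¹₀(Γ)`;
every `f ∈ L²(Γ)` is admissible. -/
def IsSource {d : ℕ} (Γ : Set (Space d)) (f : Space d → ℝ) : Prop :=
  ∀ v : Space d → ℝ, MemH10 Γ v → IntegrableOn (fun x => f x * v x) Γ

/-- The bilinear form `∫_Γ a ∇u · ∇v`. -/
def energyForm {d : ℕ} (Γ : Set (Space d)) (a u v : Space d → ℝ) : ℝ :=
  ∫ x in Γ, a x * inner ℝ (weakGrad Γ u x) (weakGrad Γ v x)

/-- `u` solves `-div (a ∇u) = f` in `Γ`, `u = 0` on `∂Γ`, in the variational sense. -/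
def IsWeakSolution {d : ℕ} (Γ : Set (Space d)) (a f u : Space d → ℝ) : Prop :=
  MemH10 Γ u ∧ ∀ v : Space d → ℝ, MemH10 Γ v → energyForm Γ a u v = ∫ x in Γ, f x * v x

/-! ### Meshes and piecewise linear finite elements -/

/-- `K` is a (conforming, finite, simplicial) mesh in `Γ`: a finite simplicial complex all of whose
faces are faces of `d`-dimensional cells, which are contained in the closure of `Γ`. -/
structure IsMesh {d : ℕ} (Γ : Set (Space d)) (K : Geometry.SimplicialComplex ℝ (Space d)) :
    Prop where
  finite : K.faces.Finite
  pure : ∀ s ∈ K.faces, ∃ t ∈ K.faces, s ⊆ t ∧ t.card = d + 1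
  subset : K.space ⊆ closure Γ

/-- A shape-regular family of meshes in `Γ`, indexed by the mesh size `h` in a set `M` of positive
numbers that is closed under halving. As `h → 0` the meshes exhaust `Γ`; this is automatic when
every mesh covers `Γ`, as for polyhedral domains. -/
structure IsMeshFamily {d : ℕ} (Γ : Set (Space d)) (M : Set ℝ)
    (T : ℝ → Geometry.SimplicialComplex ℝ (Space d)) : Prop where
  pos : ∀ h ∈ M, 0 < h
  half : ∀ h ∈ M, h / 2 ∈ M
  mesh : ∀ h ∈ M, IsMesh Γ (T h)
  exhausts : ∀ K : Set (Space d), IsCompact K → K ⊆ Γ →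
    ∃ h₁ : ℝ, 0 < h₁ ∧ ∀ h ∈ M, h ≤ h₁ → K ⊆ (T h).space
  /-- the diameters of the cells are `O(h)` -/
  size : ∃ κ : ℝ, 0 < κ ∧ ∀ h ∈ M, ∀ s ∈ (T h).faces, s.card = d + 1 →
    Metric.diam (convexHull ℝ (s : Set (Space d))) ≤ κ * h
  /-- every cell contains a ball of radius comparable to its diameter -/
  shape : ∃ ρ : ℝ, 0 < ρ ∧ ∀ h ∈ M, ∀ s ∈ (T h).faces, s.card = d + 1 →
    ∃ c : Space d, Metric.ball c (ρ * Metric.diam (convexHull ℝ (s : Set (Space d)))) ⊆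
      convexHull ℝ (s : Set (Space d))

/-- `v ∈ V_h`: `v` is continuous, affine on every cell of the mesh, and vanishes off `Γ` (so on
`∂Γ`) and off the region covered by the mesh. -/
structure MemFE {d : ℕ} (Γ : Set (Space d)) (K : Geometry.SimplicialComplex ℝ (Space d))
    (v : Space d → ℝ) : Prop where
  continuous : Continuous v
  affine : ∀ s ∈ K.faces, ∃ A : Space d →ᵃ[ℝ] ℝ, EqOn v A (convexHull ℝ (s : Set (Space d)))
  zero_off : ∀ x, x ∉ K.space ∩ Γ → v x = 0

/-- `u` is the Galerkin solution, with exact integrals, on the mesh `K`. -/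
def IsGalerkinSolution {d : ℕ} (Γ : Set (Space d)) (K : Geometry.SimplicialComplex ℝ (Space d))
    (a f u : Space d → ℝ) : Prop :=
  MemFE Γ K u ∧ ∀ v : Space d → ℝ, MemFE Γ K v → energyForm Γ a u v = ∫ x in Γ, f x * v x

/-- The Galerkin error `(g, u - u_h)` in the observable `g`. -/
def galerkinError {d : ℕ} (Γ : Set (Space d)) (g u uh : Space d → ℝ) : ℝ :=
  ∫ x in Γ, g x * (u x - uh x)

/-- The quantity `∫_Γ a |∇(u' - u) · ∇(l' - l)|`, for two pairs of functions. -/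
def scaleIntegral {d : ℕ} (Γ : Set (Space d)) (a u' u l' l : Space d → ℝ) : ℝ :=
  ∫ x in Γ, a x * |inner ℝ (weakGrad Γ (fun y => u' y - u y) x)
    (weakGrad Γ (fun y => l' y - l y) x)|

end

/-! The argument is pathwise. Write a(·,·) for the energy form, and U_n, V_n for the primal and dual
Galerkin solutions at mesh size h/2^n. Testing the dual problem with u - U_0 and subtracting V_0 by
Galerkin orthogonality gives (g, u - U_0) = a(u - U_0, λ - V_0). Telescoping both arguments over the
scales turns a(U_n - U_0, V_n - V_0) into a double sum of a(U_{k+1} - U_k, V_{l+1} - V_l). The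
hypothesis bounds each term by C (h/2^k)^α (h/2^l)^β, so two geometric series bound the sum
uniformly in n, with the same C.

It remains to let n → ∞, which needs U_n → u and V_n → λ in energy, without any rate. By Céa's lemma
(`IsWeakSolution.energyForm_sub_galerkin_le`) it is enough to approximate u from the finite element
spaces. Test functions are dense in H¹₀ by definition, and shape regularity makes their piecewise
affine interpolants converge in the Lipschitz seminorm
(`IsMeshFamily.exists_memFE_lipschitzWith_sub`).

Both orthogonality and Céa's lemma need V_h ⊂ H¹₀(Γ), for an arbitrary bounded open Γ. A finite
element function is globally Lipschitz (`MemFE.exists_lipschitzWith`), and a Lipschitz function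
vanishing off Γ is an H¹ limit of test functions: truncate it near its zero set, then mollify
(`LipschitzWith.memH10`). -/

section

variable {d : ℕ} {Γ : Set (Space d)}

/-! ### Gradients, test functions and weak gradients -/

theorem isFiniteMeasure_restrict_of_isBounded (hΓb : Bornology.IsBounded Γ) :
    IsFiniteMeasure (volume.restrict Γ) :=
  isFiniteMeasure_restrict.2 hΓb.measure_lt_top.ne

theorem inner_gradient_eq_fderiv (φ : Space d → ℝ) (x e : Space d) :
    inner ℝ e (gradient φ x) = fderiv ℝ φ x e := by
  rw [real_inner_comm]; exact inner_gradient_left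

theorem norm_gradient (φ : Space d → ℝ) (x : Space d) : ‖gradient φ x‖ = ‖fderiv ℝ φ x‖ := by
  simp [gradient]

/-- The bound holds at every point, since the gradient is 0 by default where v is not
differentiable. -/
theorem norm_gradient_le_of_lipschitzWith {v : Space d → ℝ} {K : NNReal} (hv : LipschitzWith K v)
    (x : Space d) : ‖gradient v x‖ ≤ K := by
  rw [norm_gradient]; exact norm_fderiv_le_of_lipschitz ℝ hv

theorem measurable_gradient (v : Space d → ℝ) : Measurable (gradient v) :=
  (InnerProductSpace.toDual ℝ (Space d)).symm.continuous.measurable.comp (measurable_fderiv ℝ v)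

theorem gradient_sub {v w : Space d → ℝ} {x : Space d} (hv : DifferentiableAt ℝ v x)
    (hw : DifferentiableAt ℝ w x) :
    gradient (fun y => v y - w y) x = gradient v x - gradient w x := by
  simp only [gradient]
  rw [fderiv_fun_sub hv hw, map_sub]

namespace IsTestFunction

variable {φ ψ : Space d → ℝ}

theorem continuous_gradient (h : IsTestFunction Γ φ) : Continuous (gradient φ) :=
  (InnerProductSpace.toDual ℝ (Space d)).symm.continuous.comp
    (h.smooth.continuous_fderiv (by simp))

theorem differentiable (h : IsTestFunction Γ φ) : Differentiable ℝ φ :=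
  h.smooth.differentiable (by simp)

theorem exists_lipschitzWith (h : IsTestFunction Γ φ) : ∃ K, LipschitzWith K φ :=
  (h.smooth.of_le (by exact_mod_cast le_top)).lipschitzWith_of_hasCompactSupport
    (n := 1) h.compact (by simp)

theorem eq_zero_of_notMem (h : IsTestFunction Γ φ) {x : Space d} (hx : x ∉ Γ) : φ x = 0 :=
  image_eq_zero_of_notMem_tsupport fun hx' => hx (h.support hx')

theorem gradient_eq_zero (_h : IsTestFunction Γ φ) {x : Space d} (hx : x ∉ tsupport φ) :
    gradient φ x = 0 := by
  have : fderiv ℝ φ x = 0 := by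
    by_contra h'
    exact hx (support_fderiv_subset ℝ h')
  simp [gradient, this]

theorem sub (hφ : IsTestFunction Γ φ) (hψ : IsTestFunction Γ ψ) :
    IsTestFunction Γ (fun x => φ x - ψ x) where
  smooth := hφ.smooth.sub hψ.smooth
  compact := hφ.compact.sub hψ.compact
  support := (tsupport_sub φ ψ).trans (union_subset hφ.support hψ.support)

theorem integrableOn_smul (h : IsTestFunction Γ φ) {G : Space d → Space d}
    (hG : LocallyIntegrableOn G Γ) : IntegrableOn (fun x => φ x • G x) Γ := by
  have h1 := (hG.integrableOn_compact_subset h.support h.compact).continuousOn_smul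
    h.smooth.continuous.continuousOn h.compact
  exact (h1.integrable_of_forall_notMem_eq_zero fun x hx => by
    rw [image_eq_zero_of_notMem_tsupport hx, zero_smul]).integrableOn

theorem integrableOn_smul_gradient (h : IsTestFunction Γ φ) {v : Space d → ℝ}
    (hv : LocallyIntegrableOn v Γ) : IntegrableOn (fun x => v x • gradient φ x) Γ := by
  have h1 := (hv.integrableOn_compact_subset h.support h.compact).smul_continuousOn
    h.continuous_gradient.continuousOn h.compact
  exact (h1.integrable_of_forall_notMem_eq_zero fun x hx => by
    rw [h.gradient_eq_zero hx, smul_zero]).integrableOn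

end IsTestFunction

namespace HasWeakGradient

variable {v w : Space d → ℝ} {G G' : Space d → Space d}

theorem sub (hv : HasWeakGradient Γ v G) (hw : HasWeakGradient Γ w G') :
    HasWeakGradient Γ (fun x => v x - w x) (fun x => G x - G' x) where
  locInt_fun := hv.locInt_fun.sub hw.locInt_fun
  locInt_grad := hv.locInt_grad.sub hw.locInt_grad
  integral_eq φ hφ := by
    simp_rw [sub_smul, smul_sub]
    rw [integral_sub (hφ.integrableOn_smul_gradient hv.locInt_fun)
      (hφ.integrableOn_smul_gradient hw.locInt_fun),
      integral_sub (hφ.integrableOn_smul hv.locInt_grad) (hφ.integrableOn_smul hw.locInt_grad),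
      hv.integral_eq φ hφ, hw.integral_eq φ hφ]
    abel

/-- Fundamental lemma of the calculus of variations, applied to the difference of the two
candidates. It makes the choice inside `weakGrad` harmless. -/
theorem ae_eq (hΓ : IsOpen Γ) (h : HasWeakGradient Γ v G) (h' : HasWeakGradient Γ v G') :
    G =ᵐ[volume.restrict Γ] G' := by
  have key := hΓ.ae_eq_zero_of_integral_contDiff_smul_eq_zero (μ := volume)
    (f := fun x => G x - G' x) (h.locInt_grad.sub h'.locInt_grad) fun φ h1 h2 h3 => by
      have hφ : IsTestFunction Γ φ := ⟨h1, h2, h3⟩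
      rw [← setIntegral_eq_integral_of_forall_compl_eq_zero (s := Γ)
        fun x hx => by rw [hφ.eq_zero_of_notMem hx, zero_smul]]
      simp_rw [smul_sub]
      rw [integral_sub (hφ.integrableOn_smul h.locInt_grad)
        (hφ.integrableOn_smul h'.locInt_grad), sub_eq_zero, ← neg_inj,
        ← h.integral_eq φ hφ, ← h'.integral_eq φ hφ]
  rw [Filter.EventuallyEq, ae_restrict_iff' hΓ.measurableSet]
  filter_upwards [key] with x hx hxΓ
  exact sub_eq_zero.1 (hx hxΓ)

theorem weakGrad_ae_eq (hΓ : IsOpen Γ) (h : HasWeakGradient Γ v G) :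
    weakGrad Γ v =ᵐ[volume.restrict Γ] G := by
  have hex : ∃ G, HasWeakGradient Γ v G := ⟨G, h⟩
  rw [weakGrad, dif_pos hex]
  exact hex.choose_spec.ae_eq hΓ h

end HasWeakGradient

theorem hasWeakGradient_weakGrad {v : Space d → ℝ} (h : ∃ G, HasWeakGradient Γ v G) :
    HasWeakGradient Γ v (weakGrad Γ v) := by
  rw [weakGrad, dif_pos h]
  exact h.choose_spec

theorem weakGrad_sub_ae_eq (hΓ : IsOpen Γ) {v w : Space d → ℝ}
    (hv : ∃ G, HasWeakGradient Γ v G) (hw : ∃ G, HasWeakGradient Γ w G) :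
    weakGrad Γ (fun x => v x - w x) =ᵐ[volume.restrict Γ]
      fun x => weakGrad Γ v x - weakGrad Γ w x :=
  ((hasWeakGradient_weakGrad hv).sub (hasWeakGradient_weakGrad hw)).weakGrad_ae_eq hΓ

/-! ### Lipschitz functions in H¹ and H¹₀ -/

theorem memLp_gradient_of_lipschitzWith [IsFiniteMeasure (volume.restrict Γ)]
    {v : Space d → ℝ} {K : NNReal} (hv : LipschitzWith K v) :
    MemLp (gradient v) 2 (volume.restrict Γ) :=
  MemLp.of_bound (measurable_gradient v).aestronglyMeasurable K
    (ae_of_all _ (norm_gradient_le_of_lipschitzWith hv))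

/-- By Rademacher's theorem the classical gradient exists almost everywhere. Integration by parts
for the line derivative in each direction e, against a compactly supported Lipschitz function,
identifies it as the weak gradient. -/
theorem LipschitzWith.hasWeakGradient (hΓb : Bornology.IsBounded Γ)
    {v : Space d → ℝ} {K : NNReal} (hv : LipschitzWith K v) :
    HasWeakGradient Γ v (gradient v) := by
  have := isFiniteMeasure_restrict_of_isBounded hΓb
  have hG : IntegrableOn (gradient v) Γ :=
    (memLp_gradient_of_lipschitzWith hv).integrable (by norm_num)
  refine ⟨hv.continuous.locallyIntegrable.locallyIntegrableOn Γ, hG.locallyIntegrableOn, ?_⟩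
  intro φ hφ
  obtain ⟨D, hD⟩ := hφ.exists_lipschitzWith
  refine ext_inner_left ℝ fun e => ?_
  rw [inner_neg_right, ← integral_inner (hφ.integrableOn_smul hG.locallyIntegrableOn),
    ← integral_inner (hφ.integrableOn_smul_gradient
      (hv.continuous.locallyIntegrable.locallyIntegrableOn Γ))]
  simp_rw [inner_smul_right, inner_gradient_eq_fderiv]
  rw [setIntegral_eq_integral_of_forall_compl_eq_zero fun x hx => by
      rw [← inner_gradient_eq_fderiv, hφ.gradient_eq_zero fun h => hx (hφ.support h)]; simp,
    setIntegral_eq_integral_of_forall_compl_eq_zero fun x hx => by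
      rw [hφ.eq_zero_of_notMem hx, zero_mul]]
  have key := hv.integral_lineDeriv_mul_eq (μ := volume) hD hφ.compact e
  have h1 : ∀ᵐ x, lineDeriv ℝ v x e * φ x = φ x * fderiv ℝ v x e := by
    filter_upwards [hv.ae_differentiableAt] with x hx
    rw [hx.lineDeriv_eq_fderiv, mul_comm]
  have h2 : ∀ x, lineDeriv ℝ φ x (-e) * v x = -(v x * fderiv ℝ φ x e) := fun x => by
    rw [(hφ.differentiable x).lineDeriv_eq_fderiv, map_neg]; ring
  rw [integral_congr_ae h1] at key
  simp_rw [h2, integral_neg] at key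
  rw [key, neg_neg]

/-- Dominated convergence in `L²` for uniformly bounded functions on a finite measure space. -/
theorem tendsto_eLpNorm_two_zero_of_bounded {α E : Type*} [MeasurableSpace α] {μ : Measure α}
    [IsFiniteMeasure μ] [NormedAddCommGroup E] {F : ℕ → α → E}
    (hF : ∀ n, AEStronglyMeasurable (F n) μ) {B : ℝ} (hB : ∀ n, ∀ᵐ x ∂μ, ‖F n x‖ ≤ B)
    (hlim : ∀ᵐ x ∂μ, Tendsto (fun n => F n x) atTop (𝓝 0)) :
    Tendsto (fun n => eLpNorm (F n) 2 μ) atTop (𝓝 0) := by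
  have h1 : Tendsto (fun n => ∫⁻ x, ‖F n x‖ₑ ^ (2 : ℝ) ∂μ) atTop (𝓝 (∫⁻ _, 0 ∂μ)) := by
    refine tendsto_lintegral_of_dominated_convergence' (fun _ => (ENNReal.ofReal B) ^ (2 : ℝ))
      (fun n => (hF n).enorm.pow_const _) (fun n => ?_) ?_ ?_
    · filter_upwards [hB n] with x hx
      gcongr
      rw [← ofReal_norm]
      exact ENNReal.ofReal_le_ofReal hx
    · rw [lintegral_const]
      exact ENNReal.mul_ne_top (by simp) (measure_ne_top _ _)
    · filter_upwards [hlim] with x hx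
      have := (hx.enorm).ennrpow_const (2 : ℝ)
      simpa using this
  have h2 := h1.ennrpow_const (1 / 2 : ℝ)
  simp only [lintegral_zero] at h2
  rw [ENNReal.zero_rpow_of_pos (by norm_num)] at h2
  refine h2.congr fun n => ?_
  rw [eLpNorm_eq_lintegral_rpow_enorm_toReal (by norm_num) (by norm_num)]
  simp

/-- The gradient of a Lipschitz function vanishes almost everywhere on its zero set. -/
theorem LipschitzWith.gradient_ae_eq_zero {v : Space d → ℝ} {K : NNReal} (hv : LipschitzWith K v) :
    ∀ᵐ x, v x = 0 → gradient v x = 0 := by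
  rcases subsingleton_or_nontrivial (Space d) with h | h
  · exact ae_of_all _ fun x _ => Subsingleton.elim _ _
  obtain ⟨e, he⟩ := exists_ne (0 : Space d)
  set Z : Set (Space d) := {x | v x = 0 ∧ DifferentiableAt ℝ v x}
  have hZ : MeasurableSet Z :=
    (isClosed_singleton.preimage hv.continuous).measurableSet.inter
      (measurableSet_of_differentiableAt ℝ v)
  -- Multiplication by e makes v a self-map of the space. It is constant on Z, hence approximated
  -- there by the zero map with error 0, and this forces its derivative to vanish at almost every
  -- point of Z.
  have happ : ApproximatesLinearOn (fun x => v x • e) (0 : Space d →L[ℝ] Space d) Z 0 := by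
    intro x hx y hy
    simp [hx.1, hy.1]
  have key := happ.norm_fderiv_sub_le volume hZ
    (fun x => (fderiv ℝ v x).smulRight e) fun x hx =>
      (hx.2.hasFDerivAt.smul_const e).hasFDerivWithinAt
  rw [ae_restrict_iff' hZ] at key
  filter_upwards [key, hv.ae_differentiableAt] with x hx hd h0
  have h1 := hx ⟨h0, hd⟩
  have h2 : ‖(fderiv ℝ v x).smulRight e‖ = 0 := by
    have : ‖(fderiv ℝ v x).smulRight e - 0‖₊ = 0 := le_antisymm h1 bot_le
    rwa [sub_zero, nnnorm_eq_zero, ← norm_eq_zero] at this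
  rw [ContinuousLinearMap.norm_smulRight_apply, mul_eq_zero] at h2
  have h3 := h2.resolve_right (norm_ne_zero_iff.2 he)
  rwa [← norm_gradient, norm_eq_zero] at h3

/-- Truncation of `t` to the interval `[-δ, δ]`. -/
def clip (δ t : ℝ) : ℝ := max (-δ) (min t δ)

theorem lipschitzWith_clip (δ : ℝ) : LipschitzWith 1 (clip δ) :=
  (LipschitzWith.id.min_const δ).const_max (-δ)

theorem abs_clip_le {δ : ℝ} (hδ : 0 ≤ δ) (t : ℝ) : |clip δ t| ≤ δ :=
  abs_le.2 ⟨le_max_left _ _, max_le (by linarith) (min_le_right _ _)⟩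

theorem clip_eq_self {δ t : ℝ} (h : |t| ≤ δ) : clip δ t = t := by
  rw [abs_le] at h
  rw [clip, min_eq_left h.2, max_eq_right h.1]

theorem gradient_clip_comp_eq_zero {v : Space d → ℝ} (hv : Continuous v) {δ : ℝ} (hδ : 0 < δ)
    {x : Space d} (hx : δ < |v x|) : gradient (fun y => clip δ (v y)) x = 0 := by
  rcases lt_abs.1 hx with h | h
  · have : (fun y => clip δ (v y)) =ᶠ[𝓝 x] fun _ => δ := by
      filter_upwards [hv.continuousAt.eventually (lt_mem_nhds h)] with y hy
      rw [clip, min_eq_right hy.le, max_eq_right (by linarith)]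
    rw [this.gradient_eq, gradient_fun_const]
  · have : (fun y => clip δ (v y)) =ᶠ[𝓝 x] fun _ => -δ := by
      filter_upwards [hv.continuousAt.eventually (gt_mem_nhds (show v x < -δ by linarith))]
        with y hy
      rw [clip, max_eq_left (by rw [min_eq_left (by linarith)]; exact hy.le)]
    rw [this.gradient_eq, gradient_fun_const]

/-- Where v ≠ 0, the truncation is locally constant as soon as δ n < |v x|. Where v = 0, it agrees
with v near x, and the gradient of v vanishes at almost every such point. -/
theorem tendsto_gradient_clip_comp {v : Space d → ℝ} {K : NNReal} (hv : LipschitzWith K v)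
    {δ : ℕ → ℝ} (hδ : ∀ n, 0 < δ n) (hlim : Tendsto δ atTop (𝓝 0)) :
    ∀ᵐ x, Tendsto (fun n => gradient (fun y => clip (δ n) (v y)) x) atTop (𝓝 0) := by
  filter_upwards [hv.gradient_ae_eq_zero] with x hx
  refine tendsto_const_nhds.congr' ?_
  by_cases h0 : v x = 0
  · refine Eventually.of_forall fun n => ?_
    have : (fun y => clip (δ n) (v y)) =ᶠ[𝓝 x] v := by
      have h1 : |v x| < δ n := by rw [h0, abs_zero]; exact hδ n
      filter_upwards [hv.continuous.abs.continuousAt.eventually (gt_mem_nhds h1)] with y hy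
      exact clip_eq_self hy.le
    exact (this.gradient_eq.trans (hx h0)).symm
  · filter_upwards [hlim.eventually (gt_mem_nhds (abs_pos.2 h0))] with n hn
    exact (gradient_clip_comp_eq_zero hv.continuous (hδ n) hn).symm

/-- Mollification of a Lipschitz function with compact support. -/
theorem exists_testFunction_of_lipschitzWith (hΓ : IsOpen Γ) (hΓb : Bornology.IsBounded Γ)
    {w : Space d → ℝ} {K : NNReal} (hw : LipschitzWith K w) (hwc : HasCompactSupport w)
    (hwΓ : tsupport w ⊆ Γ) {ε : ENNReal} (hε : 0 < ε) :
    ∃ φ, IsTestFunction Γ φ ∧ eLpNorm (fun x => w x - φ x) 2 (volume.restrict Γ) < ε ∧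
      eLpNorm (fun x => gradient w x - gradient φ x) 2 (volume.restrict Γ) < ε := by
  have := isFiniteMeasure_restrict_of_isBounded hΓb
  obtain ⟨r, hr, hrΓ⟩ := hwc.isCompact.exists_cthickening_subset_open hΓ hwΓ
  -- The outer radii tend to 0 and stay at most r/2, so the mollified functions are supported in the
  -- closed r-thickening of the support of w, inside Γ.
  let b : ℕ → ContDiffBump (0 : Space d) := fun n =>
    ⟨r / 2 / (n + 1) / 2, r / 2 / (n + 1), by positivity, half_lt_self (by positivity)⟩
  have hbout : ∀ n, (b n).rOut = r / 2 / (n + 1) := fun n => rfl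
  have hbr : ∀ n, (b n).rOut ≤ r / 2 := fun n =>
    div_le_self (by positivity) (by have : (0:ℝ) ≤ n := n.cast_nonneg
                                    linarith)
  have hlim : Tendsto (fun n => (b n).rOut) atTop (𝓝 0) :=
    (tendsto_const_div_atTop_nhds_zero_nat (r / 2)).comp (tendsto_add_atTop_nat 1) |>.congr
      fun n => by simp [hbout]
  have hlim' : ∀ᶠ n in atTop, (b n).rOut ≤ 2 * (b n).rIn :=
    Eventually.of_forall fun n => by
      show r / 2 / (n + 1 : ℝ) ≤ 2 * (r / 2 / (n + 1 : ℝ) / 2)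
      linarith
  let ψ : ℕ → Space d → ℝ := fun n =>
    MeasureTheory.convolution ((b n).normed volume) w (ContinuousLinearMap.lsmul ℝ ℝ) volume
  let Dψ : ℕ → Space d → (Space d →L[ℝ] ℝ) := fun n =>
    MeasureTheory.convolution ((b n).normed volume) (fderiv ℝ w)
      (ContinuousLinearMap.lsmul ℝ ℝ) volume
  have hbint : ∀ n, Integrable ((b n).normed volume) := fun n => (b n).integrable_normed
  -- Differentiation falls on w rather than on the bump, so the gradient of the mollification is the
  -- mollified gradient: bounded by K and convergent almost everywhere.
  have hderiv : ∀ n x, HasFDerivAt (ψ n) (Dψ n x) x := by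
    intro n x
    refine (hasFDerivAt_integral_of_dominated_loc_of_lip (μ := volume)
      (F := fun x t => (b n).normed volume t • w (x - t))
      (F' := fun t => (b n).normed volume t • fderiv ℝ w (x - t))
      (bound := fun t => (b n).normed volume t * K) univ_mem
      (Eventually.of_forall fun y => ?_) ?_ ?_ ?_ ?_ ?_).2
    · exact ((b n).continuous_normed.smul (hw.continuous.comp (by fun_prop))).aestronglyMeasurable
    · exact ((b n).continuous_normed.smul (hw.continuous.comp
        (by fun_prop))).integrable_of_hasCompactSupport (b n).hasCompactSupport_normed.smul_right
    · exact (b n).continuous_normed.aestronglyMeasurable.smul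
        ((measurable_fderiv ℝ w).comp (by fun_prop)).aestronglyMeasurable
    · refine ae_of_all _ fun t => (LipschitzWith.of_dist_le_mul fun y z => ?_).lipschitzOnWith
      rw [dist_eq_norm, ← smul_sub, norm_smul, Real.norm_of_nonneg ((b n).nonneg_normed t),
        Real.coe_nnabs, abs_of_nonneg (mul_nonneg ((b n).nonneg_normed t) K.coe_nonneg), mul_assoc]
      refine mul_le_mul_of_nonneg_left ?_ ((b n).nonneg_normed t)
      have := hw.dist_le_mul (y - t) (z - t)
      rwa [dist_sub_right, dist_eq_norm] at this
    · exact (hbint n).mul_const _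
    · have h1 : ∀ᵐ t, DifferentiableAt ℝ w (x - t) :=
        (Measure.measurePreserving_sub_left volume x).quasiMeasurePreserving.ae hw.ae_differentiableAt
      filter_upwards [h1] with t ht
      exact ((hasFDerivAt_comp_sub t).2 ht.hasFDerivAt).fun_const_smul _
  have hbound : ∀ n x, ‖Dψ n x‖ ≤ K := by
    intro n x
    calc ‖Dψ n x‖ ≤ ∫ t, (b n).normed volume t * K :=
          norm_integral_le_of_norm_le ((hbint n).mul_const _) (ae_of_all _ fun t => by
            show ‖(b n).normed volume t • fderiv ℝ w (x - t)‖ ≤ _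
            rw [norm_smul, Real.norm_of_nonneg ((b n).nonneg_normed t)]
            exact mul_le_mul_of_nonneg_left (norm_fderiv_le_of_lipschitz ℝ hw)
              ((b n).nonneg_normed t))
      _ = K := by rw [integral_mul_const, (b n).integral_normed, one_mul]
  have htest : ∀ n, IsTestFunction Γ (ψ n) := by
    intro n
    have hsub : tsupport (ψ n) ⊆ Metric.cthickening r (tsupport w) := by
      refine closure_minimal (fun x hx => ?_) Metric.isClosed_cthickening
      obtain ⟨y, hy, z, hz, rfl⟩ := support_convolution_subset _ hx
      rw [(b n).support_normed_eq] at hy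
      refine Metric.mem_cthickening_of_dist_le _ z _ _ (subset_tsupport w hz) ?_
      rw [Metric.mem_ball, dist_zero_right] at hy
      have := hbr n
      simp only [dist_eq_norm, add_sub_cancel_right]
      linarith
    refine ⟨(b n).hasCompactSupport_normed.contDiff_convolution_left _ (b n).contDiff_normed
      hw.continuous.locallyIntegrable, ?_, hsub.trans hrΓ⟩
    exact hwc.isCompact.cthickening.of_isClosed_subset (isClosed_tsupport _) hsub
  obtain ⟨B, hB⟩ : ∃ B, ∀ x, ‖w x‖ ≤ B := hwc.exists_bound_of_continuous hw.continuous
  have hψB : ∀ n x, ‖ψ n x‖ ≤ B := by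
    intro n x
    calc ‖ψ n x‖ ≤ ∫ t, (b n).normed volume t * B :=
          norm_integral_le_of_norm_le ((hbint n).mul_const _) (ae_of_all _ fun t => by
            show ‖(b n).normed volume t • w (x - t)‖ ≤ _
            rw [norm_smul, Real.norm_of_nonneg ((b n).nonneg_normed t)]
            exact mul_le_mul_of_nonneg_left (hB _) ((b n).nonneg_normed t))
      _ = B := by rw [integral_mul_const, (b n).integral_normed, one_mul]
  have hgrad : ∀ n x, gradient (ψ n) x = (InnerProductSpace.toDual ℝ (Space d)).symm (Dψ n x) :=
    fun n x => by rw [gradient, (hderiv n x).fderiv]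
  have hlim1 : Tendsto (fun n => eLpNorm (fun x => w x - ψ n x) 2 (volume.restrict Γ))
      atTop (𝓝 0) := by
    refine tendsto_eLpNorm_two_zero_of_bounded (B := B + B) (fun n =>
      (hw.continuous.sub (htest n).smooth.continuous).aestronglyMeasurable)
      (fun n => ae_of_all _ fun x => (norm_sub_le _ _).trans (add_le_add (hB x) (hψB n x)))
      (ae_restrict_of_ae ?_)
    filter_upwards [ContDiffBump.ae_convolution_tendsto_right_of_locallyIntegrable hlim hlim'
      hw.continuous.locallyIntegrable] with x hx
    simpa using (tendsto_const_nhds (x := w x)).sub hx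
  have hlim2 : Tendsto (fun n => eLpNorm (fun x => gradient w x - gradient (ψ n) x) 2
      (volume.restrict Γ)) atTop (𝓝 0) := by
    refine tendsto_eLpNorm_two_zero_of_bounded (B := K + K) (fun n =>
      ((measurable_gradient _).sub (measurable_gradient _)).aestronglyMeasurable)
      (fun n => ae_of_all _ fun x => (norm_sub_le _ _).trans (add_le_add
        (norm_gradient_le_of_lipschitzWith hw x) ?_))
      (ae_restrict_of_ae ?_)
    · rw [hgrad, LinearIsometryEquiv.norm_map]; exact hbound n x
    have hloc : LocallyIntegrable (fderiv ℝ w) :=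
      (locallyIntegrable_const (K : ℝ)).mono (measurable_fderiv ℝ w).aestronglyMeasurable
        (ae_of_all _ fun x => by
          rw [Real.norm_of_nonneg K.coe_nonneg]; exact norm_fderiv_le_of_lipschitz ℝ hw)
    filter_upwards [ContDiffBump.ae_convolution_tendsto_right_of_locallyIntegrable hlim hlim'
      hloc] with x hx
    have h1 := ((InnerProductSpace.toDual ℝ (Space d)).symm.continuous.tendsto _).comp hx
    simp_rw [hgrad]
    simpa [gradient] using (tendsto_const_nhds (x := gradient w x)).sub h1
  obtain ⟨n, h1, h2⟩ := ((hlim1.eventually (gt_mem_nhds hε)).and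
    (hlim2.eventually (gt_mem_nhds hε))).exists
  exact ⟨ψ n, htest n, h1, h2⟩

theorem LipschitzWith.weakGrad_ae_eq (hΓ : IsOpen Γ) (hΓb : Bornology.IsBounded Γ)
    {v : Space d → ℝ} {K : NNReal} (hv : LipschitzWith K v) :
    weakGrad Γ v =ᵐ[volume.restrict Γ] gradient v :=
  (hv.hasWeakGradient hΓb).weakGrad_ae_eq hΓ

/-- Subtracting the truncation `clip δ v` leaves a function supported in {|v| ≥ δ}, a closed subset
of Γ, hence compact, so it can be mollified. The truncation itself is small in H¹ for small δ. No
regularity of the boundary enters. -/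
theorem LipschitzWith.exists_testFunction (hΓ : IsOpen Γ) (hΓb : Bornology.IsBounded Γ)
    {v : Space d → ℝ} {K : NNReal} (hv : LipschitzWith K v) (h0 : ∀ x ∉ Γ, v x = 0)
    {ε : ENNReal} (hε : 0 < ε) :
    ∃ φ, IsTestFunction Γ φ ∧ eLpNorm (fun x => v x - φ x) 2 (volume.restrict Γ) < ε ∧
      eLpNorm (fun x => gradient v x - gradient φ x) 2 (volume.restrict Γ) < ε := by
  have := isFiniteMeasure_restrict_of_isBounded hΓb
  let δ : ℕ → ℝ := fun n => 1 / ((n : ℝ) + 1)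
  have hδ : ∀ n, 0 < δ n := fun n => by positivity
  have hδ1 : ∀ n, δ n ≤ 1 := fun n => by
    rw [div_le_one (by positivity)]; have : (0 : ℝ) ≤ n := n.cast_nonneg
    linarith
  have hδlim : Tendsto δ atTop (𝓝 0) := tendsto_one_div_add_atTop_nhds_zero_nat
  have hcl : ∀ n, LipschitzWith K (fun y => clip (δ n) (v y)) := fun n => by
    simpa [Function.comp_def] using (lipschitzWith_clip (δ n)).comp hv
  have hlim1 : Tendsto (fun n => eLpNorm (fun y => clip (δ n) (v y)) 2 (volume.restrict Γ))
      atTop (𝓝 0) :=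
    tendsto_eLpNorm_two_zero_of_bounded (B := 1)
      (fun n => (hcl n).continuous.aestronglyMeasurable)
      (fun n => ae_of_all _ fun x => (abs_clip_le (hδ n).le _).trans (hδ1 n))
      (ae_of_all _ fun x => squeeze_zero_norm (fun n => abs_clip_le (hδ n).le _) hδlim)
  have hlim2 : Tendsto (fun n => eLpNorm (gradient fun y => clip (δ n) (v y)) 2
      (volume.restrict Γ)) atTop (𝓝 0) :=
    tendsto_eLpNorm_two_zero_of_bounded (B := K)
      (fun n => (measurable_gradient _).aestronglyMeasurable)
      (fun n => ae_of_all _ fun x => norm_gradient_le_of_lipschitzWith (hcl n) x)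
      (ae_restrict_of_ae (tendsto_gradient_clip_comp hv hδ hδlim))
  have hε2 : 0 < ε / 2 := ENNReal.half_pos hε.ne'
  obtain ⟨n, h1, h2⟩ := ((hlim1.eventually (gt_mem_nhds hε2)).and
    (hlim2.eventually (gt_mem_nhds hε2))).exists
  have hwL := hv.sub (hcl n)
  set w : Space d → ℝ := fun x => v x - clip (δ n) (v x) with hw
  have hsupp : tsupport w ⊆ {x | δ n ≤ |v x|} := by
    refine closure_minimal (fun x hx => ?_) (isClosed_le continuous_const hv.continuous.abs)
    by_contra h
    exact hx (sub_eq_zero.2 (clip_eq_self (not_le.1 h).le).symm)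
  have hwΓ : tsupport w ⊆ Γ := fun x hx => by
    by_contra h
    have h3 : δ n ≤ |v x| := hsupp hx
    rw [h0 x h, abs_zero] at h3
    exact absurd h3 (not_le.2 (hδ n))
  have hwc : HasCompactSupport w :=
    Metric.isCompact_of_isClosed_isBounded (isClosed_tsupport _) (hΓb.subset hwΓ)
  obtain ⟨φ, hφ, h3, h4⟩ := exists_testFunction_of_lipschitzWith hΓ hΓb hwL hwc hwΓ hε2
  refine ⟨φ, hφ, ?_, ?_⟩
  · calc eLpNorm (fun x => v x - φ x) 2 (volume.restrict Γ)
        = eLpNorm ((fun x => w x - φ x) + fun x => clip (δ n) (v x)) 2 (volume.restrict Γ) := by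
          congr 1; ext x; simp [hw]; ring
      _ ≤ _ := eLpNorm_add_le
          (hwL.continuous.sub hφ.smooth.continuous).aestronglyMeasurable
          (hcl n).continuous.aestronglyMeasurable (by norm_num)
      _ < ε / 2 + ε / 2 := ENNReal.add_lt_add h3 h1
      _ = ε := ENNReal.add_halves ε
  · calc eLpNorm (fun x => gradient v x - gradient φ x) 2 (volume.restrict Γ)
        = eLpNorm ((fun x => gradient w x - gradient φ x) + gradient fun x => clip (δ n) (v x)) 2
            (volume.restrict Γ) := by
          refine eLpNorm_congr_ae (ae_restrict_of_ae ?_)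
          filter_upwards [hv.ae_differentiableAt, (hcl n).ae_differentiableAt] with x hx hx'
          simp only [Pi.add_apply, hw, gradient_sub hx hx']
          abel
      _ ≤ _ := eLpNorm_add_le
          ((measurable_gradient _).sub (measurable_gradient _)).aestronglyMeasurable
          (measurable_gradient _).aestronglyMeasurable (by norm_num)
      _ < ε / 2 + ε / 2 := ENNReal.add_lt_add h4 h2
      _ = ε := ENNReal.add_halves ε

theorem LipschitzWith.memH1 (hΓ : IsOpen Γ) (hΓb : Bornology.IsBounded Γ)
    {v : Space d → ℝ} {K : NNReal} (hv : LipschitzWith K v) : MemH1 Γ v := by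
  have := isFiniteMeasure_restrict_of_isBounded hΓb
  refine ⟨?_, ⟨_, hv.hasWeakGradient hΓb⟩,
    (memLp_gradient_of_lipschitzWith hv).ae_eq (hv.weakGrad_ae_eq hΓ hΓb).symm⟩
  obtain ⟨B, hB⟩ := (hΓb.isCompact_closure.image hv.continuous).isBounded.exists_norm_le
  refine MemLp.of_bound hv.continuous.aestronglyMeasurable B ?_
  filter_upwards [ae_restrict_mem hΓ.measurableSet] with x hx
  exact hB _ (mem_image_of_mem _ (subset_closure hx))

/-- A Lipschitz function that vanishes outside a bounded open set `Γ` belongs to `H¹₀(Γ)`. -/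
theorem LipschitzWith.memH10 (hΓ : IsOpen Γ) (hΓb : Bornology.IsBounded Γ)
    {v : Space d → ℝ} {K : NNReal} (hv : LipschitzWith K v) (h0 : ∀ x ∉ Γ, v x = 0) :
    MemH10 Γ v := by
  refine ⟨hv.memH1 hΓ hΓb, ?_⟩
  -- For n = 0 the inverse is ⊤, which is still positive.
  have hpos : ∀ n : ℕ, (0 : ENNReal) < (n : ENNReal)⁻¹ := fun n => by simp
  choose φ hφ h1 h2 using fun n : ℕ => hv.exists_testFunction hΓ hΓb h0 (hpos n)
  refine ⟨φ, hφ, ?_, ?_⟩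
  · exact tendsto_of_tendsto_of_tendsto_of_le_of_le tendsto_const_nhds
      ENNReal.tendsto_inv_nat_nhds_zero (fun _ => zero_le) fun n => (h1 n).le
  · refine tendsto_of_tendsto_of_tendsto_of_le_of_le tendsto_const_nhds
      ENNReal.tendsto_inv_nat_nhds_zero (fun _ => zero_le) fun n => ?_
    refine (eLpNorm_congr_ae ?_).trans_le (h2 n).le
    filter_upwards [hv.weakGrad_ae_eq hΓ hΓb] with x hx
    rw [hx]

theorem MemH1.sub (hΓ : IsOpen Γ) {v w : Space d → ℝ} (hv : MemH1 Γ v) (hw : MemH1 Γ w) :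
    MemH1 Γ (fun x => v x - w x) where
  memLp_fun := hv.memLp_fun.sub hw.memLp_fun
  hasGrad := ⟨_, (hasWeakGradient_weakGrad hv.hasGrad).sub (hasWeakGradient_weakGrad hw.hasGrad)⟩
  memLp_grad := (hv.memLp_grad.sub hw.memLp_grad).ae_eq
    (weakGrad_sub_ae_eq hΓ hv.hasGrad hw.hasGrad).symm

theorem MemH10.sub (hΓ : IsOpen Γ) {v w : Space d → ℝ} (hv : MemH10 Γ v) (hw : MemH10 Γ w) :
    MemH10 Γ (fun x => v x - w x) := by
  obtain ⟨hv1, φ, hφ, hφ1, hφ2⟩ := hv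
  obtain ⟨hw1, ψ, hψ, hψ1, hψ2⟩ := hw
  refine ⟨hv1.sub hΓ hw1, fun n x => φ n x - ψ n x, fun n => (hφ n).sub (hψ n), ?_, ?_⟩
  · refine tendsto_of_tendsto_of_tendsto_of_le_of_le tendsto_const_nhds
      (by simpa using hφ1.add hψ1) (fun _ => zero_le) fun n => ?_
    refine le_trans (le_of_eq ?_) (eLpNorm_sub_le
      (hv1.memLp_fun.1.sub (hφ n).smooth.continuous.aestronglyMeasurable)
      (hw1.memLp_fun.1.sub (hψ n).smooth.continuous.aestronglyMeasurable) (by norm_num))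
    congr 1; ext x; simp; ring
  · refine tendsto_of_tendsto_of_tendsto_of_le_of_le tendsto_const_nhds
      (by simpa using hφ2.add hψ2) (fun _ => zero_le) fun n => ?_
    refine le_trans (le_of_eq ?_) (eLpNorm_sub_le
      (hv1.memLp_grad.1.sub (hφ n).continuous_gradient.aestronglyMeasurable)
      (hw1.memLp_grad.1.sub (hψ n).continuous_gradient.aestronglyMeasurable) (by norm_num))
    refine eLpNorm_congr_ae ?_
    filter_upwards [weakGrad_sub_ae_eq hΓ hv1.hasGrad hw1.hasGrad] with x hx
    rw [hx, gradient_sub ((hφ n).differentiable x) ((hψ n).differentiable x)]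
    simp only [Pi.sub_apply]
    abel

/-! ### Gluing Lipschitz bounds over a finite closed cover -/

section ClosedCover

variable {E ι : Type*} [NormedAddCommGroup E] [NormedSpace ℝ E] [Finite ι]

/-- Restrict f to the segment from x to y. By finiteness, some C i contains γ z for z arbitrarily
close to t from the right, and γ t too because it is closed. So the lower right derivative is at
most K‖y - x‖, and the mean value inequality for Dini derivatives applies. -/
theorem sub_le_mul_norm_of_finite_closed_cover {C : ι → Set E} (hC : ∀ i, IsClosed (C i))
    (hcover : ∀ x, ∃ i, x ∈ C i) {f : E → ℝ} (hf : Continuous f) {K : NNReal}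
    (hK : ∀ i, LipschitzOnWith K f (C i)) (x y : E) : f y - f x ≤ K * ‖y - x‖ := by
  let γ : ℝ → E := fun t => x + t • (y - x)
  have hγ : Continuous γ := by fun_prop
  have hB : ∀ t : ℝ, HasDerivAt (fun t : ℝ => f x + K * ‖y - x‖ * t) (K * ‖y - x‖) t := fun t => by
    simpa using ((hasDerivAt_id t).const_mul (K * ‖y - x‖)).const_add (f x)
  have key := image_le_of_liminf_slope_right_le_deriv_boundary (f := f ∘ γ) (a := 0) (b := 1)
    (B := fun t => f x + K * ‖y - x‖ * t) (B' := fun _ => K * ‖y - x‖)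
    (hf.comp hγ).continuousOn (by simp [γ]) (by fun_prop)
    (fun t _ => (hB t).hasDerivWithinAt) ?_ (right_mem_Icc.2 zero_le_one)
  · have h1 : γ 1 = y := by
      show x + (1 : ℝ) • (y - x) = y
      rw [one_smul, add_sub_cancel]
    have h2 : f (γ 1) ≤ f x + K * ‖y - x‖ * 1 := key
    rw [h1] at h2
    linarith
  intro t _ r hr
  obtain ⟨i, hi⟩ : ∃ i, ∃ᶠ z in 𝓝[>] t, γ z ∈ C i := by
    by_contra! h
    obtain ⟨z, hz⟩ := (eventually_all.2 h).exists
    obtain ⟨i, hi⟩ := hcover (γ z)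
    exact hz i hi
  have ht : γ t ∈ C i := (hC i).mem_of_frequently_of_tendsto hi
    (hγ.continuousAt.tendsto.mono_left nhdsWithin_le_nhds)
  refine (hi.and_eventually self_mem_nhdsWithin).mono fun z ⟨hz, hzt⟩ => lt_of_le_of_lt ?_ hr
  have hzt' : 0 < z - t := sub_pos.2 hzt
  rw [slope_def_field, div_le_iff₀ hzt']
  have h1 := (le_abs_self _).trans ((hK i).dist_le_mul _ hz _ ht)
  have h2 : dist (γ z) (γ t) = ‖y - x‖ * (z - t) := by
    rw [dist_eq_norm, show γ z - γ t = (z - t) • (y - x) by simp [γ, sub_smul], norm_smul,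
      Real.norm_of_nonneg hzt'.le, mul_comm]
  rw [h2, ← mul_assoc] at h1
  exact h1

/-- A continuous function that is Lipschitz on each set of a finite closed cover of a normed space
is Lipschitz with the same constant. -/
theorem lipschitzWith_of_finite_closed_cover {C : ι → Set E} (hC : ∀ i, IsClosed (C i))
    (hcover : ∀ x, ∃ i, x ∈ C i) {f : E → ℝ} (hf : Continuous f) {K : NNReal}
    (hK : ∀ i, LipschitzOnWith K f (C i)) : LipschitzWith K f := by
  refine LipschitzWith.of_dist_le_mul fun x y => ?_
  rw [Real.dist_eq, abs_le, dist_eq_norm]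
  have h1 := sub_le_mul_norm_of_finite_closed_cover hC hcover hf hK x y
  have h2 := sub_le_mul_norm_of_finite_closed_cover hC hcover hf hK y x
  rw [norm_sub_rev] at h1
  constructor <;> linarith

end ClosedCover

/-! ### Piecewise affine functions on simplicial complexes -/

section Complex

variable {K : Geometry.SimplicialComplex ℝ (Space d)}

theorem isClosed_convexHull_finset (s : Finset (Space d)) :
    IsClosed (convexHull ℝ (s : Set (Space d))) :=
  s.finite_toSet.isClosed_convexHull ℝ

/-- The closed cover of the space by the faces of a complex and the closure of the exterior. -/
def faceCover (K : Geometry.SimplicialComplex ℝ (Space d)) : Option K.faces → Set (Space d)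
  | none => closure K.spaceᶜ
  | some s => convexHull ℝ (s.1 : Set (Space d))

theorem isClosed_faceCover : ∀ i, IsClosed (faceCover K i)
  | none => isClosed_closure
  | some s => isClosed_convexHull_finset s.1

theorem exists_mem_faceCover (x : Space d) : ∃ i, x ∈ faceCover K i := by
  by_cases hx : x ∈ K.space
  · obtain ⟨s, hs, hxs⟩ := Geometry.SimplicialComplex.mem_space_iff.1 hx
    exact ⟨some ⟨s, hs⟩, hxs⟩
  · exact ⟨none, subset_closure hx⟩

theorem continuous_of_continuousOn_faces (hK : K.faces.Finite) {f : Space d → ℝ}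
    (hf : ∀ s ∈ K.faces, ContinuousOn f (convexHull ℝ (s : Set (Space d))))
    (h0 : ∀ x ∈ closure K.spaceᶜ, f x = 0) : Continuous f := by
  have := hK.to_subtype
  refine (locallyFinite_of_finite (faceCover K)).continuous
    (eq_univ_of_forall fun x => mem_iUnion.2 (exists_mem_faceCover x)) isClosed_faceCover ?_
  rintro (_ | s)
  · exact continuousOn_const.congr h0
  · exact hf s.1 s.2

theorem lipschitzWith_of_lipschitzOnWith_faces (hK : K.faces.Finite) {f : Space d → ℝ}
    (hfc : Continuous f) {L : NNReal}
    (hf : ∀ s ∈ K.faces, LipschitzOnWith L f (convexHull ℝ (s : Set (Space d))))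
    (h0 : ∀ x ∉ K.space, f x = 0) : LipschitzWith L f := by
  have := hK.to_subtype
  refine lipschitzWith_of_finite_closed_cover (C := faceCover K) isClosed_faceCover
    exists_mem_faceCover hfc ?_
  rintro (_ | s)
  · have h1 : EqOn f (fun _ => 0) (closure K.spaceᶜ) :=
      EqOn.closure (fun x hx => h0 x hx) hfc continuous_const
    intro x hx y hy
    rw [h1 hx, h1 hy]
    simp
  · exact hf s.1 s.2

theorem AffineMap.lipschitzWith_linear (A : Space d →ᵃ[ℝ] ℝ) :
    LipschitzWith ‖LinearMap.toContinuousLinearMap A.linear‖₊ A := by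
  refine LipschitzWith.of_dist_le_mul fun x y => ?_
  rw [dist_eq_norm, dist_eq_norm, ← vsub_eq_sub (A x), ← A.linearMap_vsub, vsub_eq_sub]
  exact (LinearMap.toContinuousLinearMap A.linear).le_opNorm _

/-- There are finitely many affine pieces, so their slopes have a common bound, which continuity
makes global. -/
theorem MemFE.exists_lipschitzWith (hK : K.faces.Finite) {v : Space d → ℝ} (hv : MemFE Γ K v) :
    ∃ L, LipschitzWith L v := by
  have := hK.to_subtype
  choose A hA using fun s : K.faces => hv.affine s.1 s.2
  obtain ⟨L, hL⟩ := Finite.exists_le fun s => ‖LinearMap.toContinuousLinearMap (A s).linear‖₊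
  refine ⟨L, lipschitzWith_of_lipschitzOnWith_faces hK hv.continuous (fun s hs => ?_)
    fun x hx => hv.zero_off x fun h => hx h.1⟩
  intro x hx y hy
  rw [hA ⟨s, hs⟩ hx, hA ⟨s, hs⟩ hy]
  exact ((A ⟨s, hs⟩).lipschitzWith_linear.weaken (hL ⟨s, hs⟩)) x y

/-- Conformity: discrete functions are admissible in the continuous problem. -/
theorem MemFE.memH10 (hΓ : IsOpen Γ) (hΓb : Bornology.IsBounded Γ) (hK : K.faces.Finite)
    {v : Space d → ℝ} (hv : MemFE Γ K v) : MemH10 Γ v := by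
  obtain ⟨L, hL⟩ := hv.exists_lipschitzWith hK
  exact hL.memH10 hΓ hΓb fun x hx => hv.zero_off x fun h => hx h.2

/-- Extend the vertices to an affine basis and combine its barycentric coordinates with weights φ.
-/
theorem exists_affineMap_eq_of_affineIndependent {s : Finset (Space d)}
    (hs : AffineIndependent ℝ ((↑) : s → Space d)) (φ : Space d → ℝ) :
    ∃ A : Space d →ᵃ[ℝ] ℝ, ∀ p ∈ s, A p = φ p := by
  classical
  obtain ⟨t, hst, hti, htop⟩ := exists_subset_affineIndependent_affineSpan_eq_top
    (s := (s : Set (Space d))) hs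
  have : Finite t := finite_set_of_fin_dim_affineIndependent ℝ hti
  have := Fintype.ofFinite t
  let b : AffineBasis t ℝ (Space d) := ⟨(↑), hti, by rwa [Subtype.range_coe]⟩
  refine ⟨(Fintype.linearCombination ℝ fun i : t => φ i).toAffineMap.comp b.coords,
    fun p hp => ?_⟩
  have hb : b ⟨p, hst hp⟩ = p := rfl
  simp only [AffineMap.comp_apply, LinearMap.coe_toAffineMap, Fintype.linearCombination_apply,
    AffineBasis.coords_apply]
  conv_lhs => rw [← hb]
  simp [AffineBasis.coord_apply]

theorem AffineMap.eqOn_convexHull {A B : Space d →ᵃ[ℝ] ℝ} {s : Set (Space d)}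
    (h : EqOn A B s) : EqOn A B (convexHull ℝ s) := by
  intro x hx
  have hx' : (A - B) x ∈ convexHull ℝ ((A - B) '' s) := by
    rw [← AffineMap.image_convexHull]; exact mem_image_of_mem _ hx
  have h0 : (A - B) '' s ⊆ {0} := by
    rintro _ ⟨y, hy, rfl⟩
    simp [h hy]
  have := convexHull_min h0 (convex_singleton _) hx'
  simpa [sub_eq_zero] using this

/-- The piecewise affine function with prescribed values at the vertices of a complex. -/
theorem exists_piecewiseAffine (K : Geometry.SimplicialComplex ℝ (Space d)) (φ : Space d → ℝ) :
    ∃ v : Space d → ℝ, (∀ s ∈ K.faces, ∃ A : Space d →ᵃ[ℝ] ℝ,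
      EqOn v A (convexHull ℝ (s : Set (Space d))) ∧ ∀ p ∈ s, A p = φ p) ∧
      ∀ x ∉ K.space, v x = 0 := by
  classical
  choose A hA using fun s : K.faces => exists_affineMap_eq_of_affineIndependent (K.indep s.2) φ
  refine ⟨fun x => if h : ∃ s : K.faces, x ∈ convexHull ℝ (s.1 : Set (Space d)) then
    A h.choose x else 0, fun s hs => ⟨A ⟨s, hs⟩, fun x hx => ?_, hA ⟨s, hs⟩⟩, fun x hx => ?_⟩
  · have h : ∃ s : K.faces, x ∈ convexHull ℝ (s.1 : Set (Space d)) := ⟨⟨s, hs⟩, hx⟩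
    simp only [dif_pos h]
    -- The value does not depend on the chosen face: two faces meet inside the hull of their common
    -- vertices, where both affine maps take the values of φ.
    refine AffineMap.eqOn_convexHull (s := (h.choose.1 : Set (Space d)) ∩ s) (fun p hp => ?_)
      (K.inter_subset_convexHull h.choose.2 hs ⟨h.choose_spec, hx⟩)
    rw [hA _ p hp.1, hA ⟨s, hs⟩ p hp.2]
  · refine dif_neg ?_
    rintro ⟨s, hs⟩
    exact hx (Geometry.SimplicialComplex.mem_space_iff.2 ⟨s.1, s.2, hs⟩)

end Complex

/-! ### Interpolation of test functions -/

/-- The interpolation error on one simplex is Lipschitz, with a constant that is controlled by the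
oscillation of the derivative and by the aspect ratio of the simplex. -/
theorem lipschitzOnWith_interpolation_error {s : Finset (Space d)} {φ : Space d → ℝ}
    (hφ : Differentiable ℝ φ) {A : Space d →ᵃ[ℝ] ℝ} (hA : ∀ p ∈ s, A p = φ p) {η ρ : ℝ}
    (hρ : 0 < ρ) (hdiam : 0 < Metric.diam (convexHull ℝ (s : Set (Space d))))
    (hη : ∀ x ∈ convexHull ℝ (s : Set (Space d)), ∀ y ∈ convexHull ℝ (s : Set (Space d)),
      ‖fderiv ℝ φ x - fderiv ℝ φ y‖ ≤ η) {c : Space d}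
    (hc : Metric.ball c (ρ * Metric.diam (convexHull ℝ (s : Set (Space d)))) ⊆
      convexHull ℝ (s : Set (Space d))) :
    LipschitzOnWith ((2 / ρ + 1) * η).toNNReal (fun x => A x - φ x)
      (convexHull ℝ (s : Set (Space d))) := by
  set S := convexHull ℝ (s : Set (Space d)) with hS
  set D := Metric.diam S with hD
  have hr : 0 < ρ * D := mul_pos hρ hdiam
  have hcS : c ∈ S := hc (Metric.mem_ball_self hr)
  have hη0 : 0 ≤ η := (norm_nonneg _).trans (hη c hcS c hcS)
  set L := fderiv ℝ φ c
  have hbdd : Bornology.IsBounded S :=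
    (isBounded_convexHull (s := (s : Set (Space d)))).2 s.finite_toSet.isBounded
  have hmean : ∀ x ∈ S, ∀ y ∈ S, ‖φ y - φ x - L (y - x)‖ ≤ η * ‖y - x‖ := fun x hx y hy =>
    (convex_convexHull ℝ _).norm_image_sub_le_of_norm_hasFDerivWithin_le'
      (fun z _ => (hφ z).hasFDerivAt.hasFDerivWithinAt) (fun z hz => hη z hz c hcS) hx hy
  -- B is A minus the linear part of φ at c. At the vertices it equals φ - L, which oscillates by at
  -- most η D, and an affine map attains its oscillation on the simplex at vertices.
  let B : Space d →ᵃ[ℝ] ℝ := A - (L : Space d →ₗ[ℝ] ℝ).toAffineMap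
  have hBapp : ∀ x, B x = A x - L x := fun x => rfl
  have hdiamB : Metric.diam (B '' S) ≤ η * D := by
    rw [hS, AffineMap.image_convexHull, convexHull_diam]
    refine Metric.diam_le_of_forall_dist_le (mul_nonneg hη0 hdiam.le) ?_
    rintro _ ⟨p, hp, rfl⟩ _ ⟨q, hq, rfl⟩
    have hpS : p ∈ S := subset_convexHull ℝ _ hp
    have hqS : q ∈ S := subset_convexHull ℝ _ hq
    have h1 := hmean q hqS p hpS
    rw [Real.dist_eq, hBapp, hBapp, hA p hp, hA q hq]
    rw [map_sub, Real.norm_eq_abs] at h1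
    calc |φ p - L p - (φ q - L q)| = |φ p - φ q - (L p - L q)| := by congr 1; ring
      _ ≤ η * ‖p - q‖ := h1
      _ ≤ η * D := by
        rw [← dist_eq_norm]
        exact mul_le_mul_of_nonneg_left (Metric.dist_le_diam_of_mem hbdd hpS hqS) hη0
  have hBbdd : Bornology.IsBounded (B '' S) := by
    rw [hS, AffineMap.image_convexHull]
    exact isBounded_convexHull.2 (s.finite_toSet.image B).isBounded
  have hlin : ∀ w, |B.linear w| ≤ 2 / ρ * η * ‖w‖ := by
    intro w
    rcases eq_or_ne w 0 with rfl | hw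
    · simp
    have hw' : 0 < ‖w‖ := norm_pos_iff.2 hw
    -- Half the inradius bound, to stay in the open ball around c. Dividing the oscillation η D by
    -- this length gives the slope 2η/ρ.
    set τ : ℝ := ρ * D / 2 / ‖w‖
    have hτ : 0 < τ := by positivity
    have hmem : τ • w + c ∈ S := by
      refine hc ?_
      rw [Metric.mem_ball, dist_eq_norm, add_sub_cancel_right, norm_smul,
        Real.norm_of_nonneg hτ.le, div_mul_cancel₀ _ hw'.ne']
      linarith
    have h1 := (Metric.dist_le_diam_of_mem hBbdd (mem_image_of_mem B hmem)
      (mem_image_of_mem B hcS)).trans hdiamB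
    rw [Real.dist_eq, ← vsub_eq_sub (B (τ • w + c)), ← B.linearMap_vsub, vsub_eq_sub,
      add_sub_cancel_right, map_smul, smul_eq_mul, abs_mul, abs_of_pos hτ] at h1
    have h2 : |B.linear w| ≤ η * D / τ := by rw [le_div_iff₀ hτ, mul_comm]; exact h1
    refine h2.trans (le_of_eq ?_)
    simp only [τ]
    field_simp
  refine LipschitzOnWith.of_dist_le_mul fun x hx y hy => ?_
  have h1 := hlin (x - y)
  rw [← vsub_eq_sub x, B.linearMap_vsub, vsub_eq_sub, vsub_eq_sub, hBapp, hBapp] at h1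
  have h2 := hmean y hy x hx
  rw [map_sub, Real.norm_eq_abs] at h2
  rw [Real.dist_eq, Real.coe_toNNReal _ (by positivity), dist_eq_norm]
  calc |A x - φ x - (A y - φ y)|
      = |(A x - L x - (A y - L y)) - (φ x - φ y - (L x - L y))| := by congr 1; ring
    _ ≤ _ := abs_sub _ _
    _ ≤ 2 / ρ * η * ‖x - y‖ + η * ‖x - y‖ := add_le_add h1 h2
    _ = _ := by ring

theorem diam_convexHull_pos_of_one_lt_card {s : Finset (Space d)} (hs : 1 < s.card) :
    0 < Metric.diam (convexHull ℝ (s : Set (Space d))) := by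
  rw [convexHull_diam]
  obtain ⟨p, hp, q, hq, hpq⟩ := Finset.one_lt_card.1 hs
  exact (dist_pos.2 hpq).trans_le (Metric.dist_le_diam_of_mem s.finite_toSet.isBounded hp hq)

theorem IsTestFunction.exists_lipschitzWith_fderiv {φ : Space d → ℝ} (h : IsTestFunction Γ φ) :
    ∃ D, LipschitzWith D (fderiv ℝ φ) :=
  (h.smooth.fderiv_right (m := 1) (by norm_cast)).lipschitzWith_of_hasCompactSupport
    (h.compact.fderiv ℝ) (by simp)

/-- Piecewise affine interpolants of a test function converge to it in the Lipschitz seminorm. -/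
theorem IsMeshFamily.exists_memFE_lipschitzWith_sub (hd : 1 ≤ d) (hΓ : IsOpen Γ) {M : Set ℝ}
    {T : ℝ → Geometry.SimplicialComplex ℝ (Space d)} (hT : IsMeshFamily Γ M T)
    {φ : Space d → ℝ} (hφ : IsTestFunction Γ φ) {ε : NNReal} (hε : 0 < ε) :
    ∃ h₁ > 0, ∀ h ∈ M, h ≤ h₁ → ∃ v, MemFE Γ (T h) v ∧ LipschitzWith ε (fun x => v x - φ x) := by
  obtain ⟨κ, hκ, hsize⟩ := hT.size
  obtain ⟨ρ, hρ, hshape⟩ := hT.shape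
  obtain ⟨D, hD⟩ := hφ.exists_lipschitzWith_fderiv
  obtain ⟨δ, hδ, hδΓ⟩ := hφ.compact.isCompact.exists_cthickening_subset_open hΓ hφ.support
  obtain ⟨h₂, hh₂, hex⟩ := hT.exhausts _ hφ.compact.isCompact.cthickening hδΓ
  obtain ⟨τ, hτ, hτε⟩ : ∃ τ > 0, (2 / ρ + 1) * (D * (κ * τ)) ≤ ε := by
    have hpos : 0 < (2 / ρ + 1) * (D * κ) + 1 := by positivity
    refine ⟨ε / ((2 / ρ + 1) * (D * κ) + 1), by positivity, ?_⟩
    rw [show (2 / ρ + 1) * (D * (κ * (ε / ((2 / ρ + 1) * (D * κ) + 1)))) =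
      ((2 / ρ + 1) * (D * κ)) * ε / ((2 / ρ + 1) * (D * κ) + 1) by ring, div_le_iff₀ hpos]
    nlinarith [ε.coe_nonneg]
  -- Below h₂ the mesh covers a neighbourhood of the support of φ, below τ the interpolation error
  -- is at most ε, and below δ/(2κ) the interpolant is supported in that neighbourhood.
  refine ⟨min h₂ (min τ (δ / κ / 2)), by positivity, fun h hM hh => ?_⟩
  have hh2 := hh.trans (min_le_left _ _)
  have hhτ := hh.trans ((min_le_right _ _).trans (min_le_left _ _))
  have hhδ : κ * h < δ := by
    have h1 := hh.trans ((min_le_right _ _).trans (min_le_right _ _))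
    calc κ * h ≤ κ * (δ / κ / 2) := mul_le_mul_of_nonneg_left h1 hκ.le
      _ = δ / 2 := by field_simp
      _ < δ := half_lt_self hδ
  have hmesh := hT.mesh h hM
  obtain ⟨v, hv, hv0⟩ := exists_piecewiseAffine (T h) φ
  have hsub := hex h hM hh2
  have hdist : ∀ s ∈ (T h).faces, ∀ x ∈ convexHull ℝ (s : Set (Space d)),
      ∀ y ∈ convexHull ℝ (s : Set (Space d)), dist x y ≤ κ * h := by
    intro s hs x hx y hy
    obtain ⟨t, ht, hst, hcard⟩ := hmesh.pure s hs
    have hmono := convexHull_mono (𝕜 := ℝ) (Finset.coe_subset.2 hst)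
    exact (Metric.dist_le_diam_of_mem (isBounded_convexHull.2 t.finite_toSet.isBounded)
      (hmono hx) (hmono hy)).trans (hsize h hM t ht hcard)
  have hsupp : ∀ x, v x ≠ 0 → x ∈ Metric.thickening δ (tsupport φ) := by
    intro x hx
    obtain ⟨s, hs, hxs⟩ := Geometry.SimplicialComplex.mem_space_iff.1
      (by_contra fun h' => hx (hv0 x h'))
    obtain ⟨A, hvA, hA⟩ := hv s hs
    obtain ⟨p, hp, hp0⟩ : ∃ p ∈ s, φ p ≠ 0 := by
      by_contra! h'
      refine hx ((hvA hxs).trans ?_)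
      exact AffineMap.eqOn_convexHull (B := 0) (fun p hp => by rw [hA p hp, h' p hp]; rfl) hxs
    refine Metric.mem_thickening_iff.2 ⟨p, subset_tsupport φ hp0, ?_⟩
    exact (hdist s hs x hxs p (subset_convexHull ℝ _ hp)).trans_lt hhδ
  have hthick := Metric.thickening_subset_cthickening δ (tsupport φ)
  have hvcont : Continuous v := by
    refine continuous_of_continuousOn_faces hmesh.finite (fun s hs => ?_) fun x hx => ?_
    · obtain ⟨A, hvA, -⟩ := hv s hs
      exact A.lipschitzWith_linear.continuous.continuousOn.congr hvA
    · by_contra h'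
      -- Points where v ≠ 0 lie in an open thickening covered by the mesh, hence in its interior.
      rw [closure_compl] at hx
      exact hx (interior_maximal (hthick.trans hsub) Metric.isOpen_thickening (hsupp x h'))
  refine ⟨v, ⟨hvcont, fun s hs => (hv s hs).imp fun A hA => hA.1, fun x hx => ?_⟩, ?_⟩
  · by_contra h'
    have := hthick (hsupp x h')
    exact hx ⟨hsub this, hδΓ this⟩
  refine lipschitzWith_of_lipschitzOnWith_faces hmesh.finite
    (hvcont.sub hφ.smooth.continuous) (fun s hs => ?_) fun x hx => ?_
  · obtain ⟨t, ht, hst, hcard⟩ := hmesh.pure s hs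
    obtain ⟨A, hvA, hA⟩ := hv t ht
    obtain ⟨c, hc⟩ := hshape h hM t ht hcard
    -- Since d ≥ 1, a cell has at least two vertices, hence positive diameter.
    have h1 := lipschitzOnWith_interpolation_error hφ.differentiable hA (η := D * (κ * h)) hρ
      (diam_convexHull_pos_of_one_lt_card (by omega)) (fun x hx y hy => by
        rw [← dist_eq_norm]
        exact (hD.dist_le_mul x y).trans
          (mul_le_mul_of_nonneg_left (hdist t ht x hx y hy) D.coe_nonneg)) hc
    have h2 : ((2 / ρ + 1) * (D * (κ * h))).toNNReal ≤ ε := by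
      rw [Real.toNNReal_le_iff_le_coe]
      exact le_trans (by gcongr) hτε
    have h3 : LipschitzOnWith ε (fun x => v x - φ x) (convexHull ℝ (t : Set (Space d))) := by
      intro x hx y hy
      have := (h1.weaken h2) hx hy
      simpa only [hvA hx, hvA hy] using this
    exact h3.mono (convexHull_mono (Finset.coe_subset.2 hst))
  · show v x - φ x = 0
    rw [hv0 x hx, image_eq_zero_of_notMem_tsupport fun h' =>
      hx (hsub (Metric.self_subset_cthickening _ h')), sub_zero]

/-! ### The energy form -/

theorem IsConductivity.exists_nonneg_bound {a : Space d → ℝ} (ha : IsConductivity Γ a) :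
    ∃ B : ℝ, 0 ≤ B ∧ ∀ᵐ x ∂(volume.restrict Γ), 0 ≤ a x ∧ a x ≤ B := by
  obtain ⟨-, m, B, hm, h⟩ := ha
  exact ⟨|B|, abs_nonneg B, h.mono fun x hx => ⟨hm.le.trans hx.1, hx.2.trans (le_abs_self B)⟩⟩

theorem IsConductivity.integrable_mul_inner {a : Space d → ℝ} (ha : IsConductivity Γ a)
    {F G : Space d → Space d} (hF : MemLp F 2 (volume.restrict Γ))
    (hG : MemLp G 2 (volume.restrict Γ)) :
    Integrable (fun x => a x * inner ℝ (F x) (G x)) (volume.restrict Γ) := by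
  obtain ⟨B, hB, hab⟩ := ha.exists_nonneg_bound
  refine ((hF.norm.integrable_mul hG.norm).const_mul B).mono'
    (ha.1.mul (hF.1.inner hG.1)) ?_
  filter_upwards [hab] with x hx
  rw [norm_mul, Real.norm_of_nonneg hx.1]
  exact mul_le_mul hx.2 (norm_inner_le_norm _ _) (norm_nonneg _) hB

section EnergyForm

variable {a u v w : Space d → ℝ}

theorem energyForm_comm : energyForm Γ a u v = energyForm Γ a v u := by
  simp only [energyForm, real_inner_comm]

theorem energyForm_sub_left (hΓ : IsOpen Γ) (ha : IsConductivity Γ a) (hu : MemH1 Γ u)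
    (hv : MemH1 Γ v) (hw : MemH1 Γ w) :
    energyForm Γ a (fun x => u x - v x) w = energyForm Γ a u w - energyForm Γ a v w := by
  rw [energyForm, energyForm, energyForm,
    ← integral_sub (ha.integrable_mul_inner hu.memLp_grad hw.memLp_grad)
      (ha.integrable_mul_inner hv.memLp_grad hw.memLp_grad)]
  refine integral_congr_ae ?_
  filter_upwards [weakGrad_sub_ae_eq hΓ hu.hasGrad hv.hasGrad] with x hx
  rw [hx, inner_sub_left, mul_sub]

theorem energyForm_sub_right (hΓ : IsOpen Γ) (ha : IsConductivity Γ a) (hu : MemH1 Γ u)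
    (hv : MemH1 Γ v) (hw : MemH1 Γ w) :
    energyForm Γ a w (fun x => u x - v x) = energyForm Γ a w u - energyForm Γ a w v := by
  rw [energyForm_comm, energyForm_sub_left hΓ ha hu hv hw, energyForm_comm,
    energyForm_comm (u := v)]

theorem energyForm_self_nonneg (ha : IsConductivity Γ a) : 0 ≤ energyForm Γ a u u := by
  obtain ⟨B, -, hab⟩ := ha.exists_nonneg_bound
  refine integral_nonneg_of_ae ?_
  filter_upwards [hab] with x hx
  exact mul_nonneg hx.1 real_inner_self_nonneg

/-- The Cauchy–Schwarz inequality for the energy form. -/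
theorem energyForm_sq_le (ha : IsConductivity Γ a) (hu : MemH1 Γ u) (hv : MemH1 Γ v) :
    energyForm Γ a u v ^ 2 ≤ energyForm Γ a u u * energyForm Γ a v v := by
  obtain ⟨B, -, hab⟩ := ha.exists_nonneg_bound
  have h1 := ha.integrable_mul_inner hu.memLp_grad hu.memLp_grad
  have h2 := ha.integrable_mul_inner hu.memLp_grad hv.memLp_grad
  have h3 := ha.integrable_mul_inner hv.memLp_grad hv.memLp_grad
  have key : ∀ t : ℝ, 0 ≤ energyForm Γ a v v * (t * t) + (-2 * energyForm Γ a u v) * t +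
      energyForm Γ a u u := by
    intro t
    have h4 : energyForm Γ a v v * (t * t) + (-2 * energyForm Γ a u v) * t +
        energyForm Γ a u u = ∫ x in Γ, a x * inner ℝ (weakGrad Γ u x - t • weakGrad Γ v x)
          (weakGrad Γ u x - t • weakGrad Γ v x) := by
      calc _ = ∫ x in Γ, ((t * t) * (a x * inner ℝ (weakGrad Γ v x) (weakGrad Γ v x)) +
            (-2 * t) * (a x * inner ℝ (weakGrad Γ u x) (weakGrad Γ v x))) +
            a x * inner ℝ (weakGrad Γ u x) (weakGrad Γ u x) := by
              rw [integral_add ((h3.const_mul _).fun_add (h2.const_mul _)) h1,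
                integral_add (h3.const_mul _) (h2.const_mul _), integral_const_mul,
                integral_const_mul, energyForm, energyForm, energyForm]
              ring
        _ = _ := by
          refine integral_congr_ae (ae_of_all _ fun x => ?_)
          simp only [inner_sub_left, inner_sub_right, real_inner_smul_left,
            real_inner_smul_right, real_inner_comm (weakGrad Γ u x) (weakGrad Γ v x)]
          ring
    rw [h4]
    refine integral_nonneg_of_ae ?_
    filter_upwards [hab] with x hx
    exact mul_nonneg hx.1 real_inner_self_nonneg
  have := discrim_le_zero key
  rw [discrim] at this
  nlinarith

theorem energyForm_self_le (ha : IsConductivity Γ a) {B : ℝ}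
    (hab : ∀ᵐ x ∂(volume.restrict Γ), 0 ≤ a x ∧ a x ≤ B) (hu : MemH1 Γ u) :
    energyForm Γ a u u ≤ B * (eLpNorm (weakGrad Γ u) 2 (volume.restrict Γ)).toReal ^ 2 := by
  have h1 : (eLpNorm (weakGrad Γ u) 2 (volume.restrict Γ)).toReal ^ 2 =
      ∫ x in Γ, ‖weakGrad Γ u x‖ ^ 2 := by
    have h0 : (0 : ℝ) ≤ ∫ x in Γ, ‖weakGrad Γ u x‖ ^ 2 :=
      integral_nonneg fun x => by positivity
    rw [hu.memLp_grad.eLpNorm_eq_integral_rpow_norm (by norm_num) (by norm_num)]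
    simp only [ENNReal.toReal_ofNat, Real.rpow_ofNat]
    rw [ENNReal.toReal_ofReal (by positivity), ← Real.rpow_natCast, ← Real.rpow_mul h0]
    norm_num
  rw [h1, ← integral_const_mul]
  refine integral_mono_ae (ha.integrable_mul_inner hu.memLp_grad hu.memLp_grad)
    ((hu.memLp_grad.integrable_norm_pow (by norm_num)).const_mul B) ?_
  filter_upwards [hab] with x hx
  rw [real_inner_self_eq_norm_sq]
  exact mul_le_mul_of_nonneg_right hx.2 (by positivity)

theorem abs_energyForm_sub_le_scaleIntegral {u' v' : Space d → ℝ} (ha : IsConductivity Γ a) :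
    |energyForm Γ a (fun x => u' x - u x) (fun x => v' x - v x)| ≤
      scaleIntegral Γ a u' u v' v := by
  obtain ⟨B, -, hab⟩ := ha.exists_nonneg_bound
  refine abs_integral_le_integral_abs.trans (le_of_eq (integral_congr_ae ?_))
  filter_upwards [hab] with x hx
  rw [abs_mul, abs_of_nonneg hx.1]

theorem tendsto_energyForm_zero (ha : IsConductivity Γ a) {U V : ℕ → Space d → ℝ}
    (hU : ∀ n, MemH1 Γ (U n)) (hV : ∀ n, MemH1 Γ (V n)) {q : ℝ}
    (h0 : Tendsto (fun n => energyForm Γ a (U n) (U n)) atTop (𝓝 0))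
    (hq : Tendsto (fun n => energyForm Γ a (V n) (V n)) atTop (𝓝 q)) :
    Tendsto (fun n => energyForm Γ a (U n) (V n)) atTop (𝓝 0) := by
  have h1 : Tendsto (fun n => energyForm Γ a (U n) (V n) ^ 2) atTop (𝓝 0) :=
    tendsto_of_tendsto_of_tendsto_of_le_of_le tendsto_const_nhds
      (by simpa using h0.mul hq) (fun n => sq_nonneg _)
      fun n => energyForm_sq_le ha (hU n) (hV n)
  have h2 := h1.sqrt
  simp only [Real.sqrt_sq_eq_abs, Real.sqrt_zero] at h2
  exact (tendsto_zero_iff_abs_tendsto_zero _).2 h2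

end EnergyForm

/-! ### Density, Céa's lemma and convergence of the Galerkin solutions -/

section Galerkin

variable {M : Set ℝ} {T : ℝ → Geometry.SimplicialComplex ℝ (Space d)}

/-- Approximate u by a test function, then that by its interpolant. A Lipschitz constant η costs at
most |Γ|^{1/2} η in L². -/
theorem IsMeshFamily.exists_memFE_eLpNorm_weakGrad_le (hd : 1 ≤ d) (hΓ : IsOpen Γ)
    (hΓb : Bornology.IsBounded Γ) (hT : IsMeshFamily Γ M T) {u : Space d → ℝ} (hu : MemH10 Γ u)
    {ε : ENNReal} (hε : 0 < ε) :
    ∃ h₁ > 0, ∀ h ∈ M, h ≤ h₁ → ∃ v, MemFE Γ (T h) v ∧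
      eLpNorm (weakGrad Γ (fun x => u x - v x)) 2 (volume.restrict Γ) ≤ ε := by
  have := isFiniteMeasure_restrict_of_isBounded hΓb
  obtain ⟨hu1, φ, hφ, -, hlim⟩ := hu
  have hε2 : 0 < ε / 2 := ENNReal.half_pos hε.ne'
  obtain ⟨n, hn⟩ := (hlim.eventually (gt_mem_nhds hε2)).exists
  obtain ⟨η, hη, hηε⟩ : ∃ η : NNReal, 0 < η ∧
      (volume.restrict Γ) univ ^ (2 : ENNReal).toReal⁻¹ * η ≤ ε / 2 := by
    have hfin : (volume.restrict Γ) univ ^ (2 : ENNReal).toReal⁻¹ ≠ ⊤ :=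
      ENNReal.rpow_ne_top_of_nonneg (by positivity) (measure_ne_top _ _)
    have ht : Tendsto (fun η : NNReal => (volume.restrict Γ) univ ^ (2 : ENNReal).toReal⁻¹ *
        (η : ENNReal)) (𝓝[>] 0) (𝓝 0) := by
      have h1 : Tendsto (fun η : NNReal => (η : ENNReal)) (𝓝[>] 0) (𝓝 0) :=
        (ENNReal.continuous_coe.tendsto' 0 0 rfl).mono_left nhdsWithin_le_nhds
      simpa using ENNReal.Tendsto.const_mul h1 (Or.inr hfin)
    obtain ⟨η, h1, h2⟩ := ((ht.eventually (gt_mem_nhds hε2)).and self_mem_nhdsWithin).exists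
    exact ⟨η, h2, h1.le⟩
  obtain ⟨h₁, hh₁, hex⟩ := hT.exists_memFE_lipschitzWith_sub hd hΓ (hφ n) hη
  refine ⟨h₁, hh₁, fun h hM hh => ?_⟩
  obtain ⟨v, hv, hlip⟩ := hex h hM hh
  refine ⟨v, hv, ?_⟩
  obtain ⟨L, hL⟩ := hv.exists_lipschitzWith (hT.mesh h hM).finite
  have hbd : eLpNorm (gradient fun x => v x - φ n x) 2 (volume.restrict Γ) ≤ ε / 2 := by
    refine (eLpNorm_le_of_ae_bound (C := η)
      (ae_of_all _ fun x => norm_gradient_le_of_lipschitzWith hlip x)).trans ?_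
    rwa [ENNReal.ofReal_coe_nnreal]
  calc eLpNorm (weakGrad Γ (fun x => u x - v x)) 2 (volume.restrict Γ)
      = eLpNorm ((fun x => weakGrad Γ u x - gradient (φ n) x) -
          gradient fun x => v x - φ n x) 2 (volume.restrict Γ) := by
        refine eLpNorm_congr_ae ?_
        filter_upwards [weakGrad_sub_ae_eq hΓ hu1.hasGrad ⟨_, hL.hasWeakGradient hΓb⟩,
          hL.weakGrad_ae_eq hΓ hΓb, ae_restrict_of_ae hL.ae_differentiableAt] with x h1 h2 h3
        rw [h1, h2, Pi.sub_apply, gradient_sub h3 ((hφ n).differentiable x)]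
        abel
    _ ≤ _ := eLpNorm_sub_le
        (hu1.memLp_grad.1.sub (hφ n).continuous_gradient.aestronglyMeasurable)
        (measurable_gradient _).aestronglyMeasurable (by norm_num)
    _ ≤ ε / 2 + ε / 2 := add_le_add hn.le hbd
    _ = ε := ENNReal.add_halves ε

variable {a f u : Space d → ℝ}

/-- Galerkin orthogonality. -/
theorem IsWeakSolution.energyForm_sub_galerkin_eq_zero (hΓ : IsOpen Γ)
    (hΓb : Bornology.IsBounded Γ) (ha : IsConductivity Γ a) (hu : IsWeakSolution Γ a f u)
    {K : Geometry.SimplicialComplex ℝ (Space d)} (hK : K.faces.Finite) {uK v : Space d → ℝ}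
    (huK : IsGalerkinSolution Γ K a f uK) (hv : MemFE Γ K v) :
    energyForm Γ a (fun x => u x - uK x) v = 0 := by
  have hv' := hv.memH10 hΓ hΓb hK
  rw [energyForm_sub_left hΓ ha hu.1.1 (huK.1.memH10 hΓ hΓb hK).1 hv'.1, hu.2 v hv', huK.2 v hv,
    sub_self]

/-- Céa's lemma: the Galerkin solution is a best approximation in the energy seminorm. -/
theorem IsWeakSolution.energyForm_sub_galerkin_le (hΓ : IsOpen Γ)
    (hΓb : Bornology.IsBounded Γ) (ha : IsConductivity Γ a) (hu : IsWeakSolution Γ a f u)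
    {K : Geometry.SimplicialComplex ℝ (Space d)} (hK : K.faces.Finite) {uK v : Space d → ℝ}
    (huK : IsGalerkinSolution Γ K a f uK) (hv : MemFE Γ K v) :
    energyForm Γ a (fun x => u x - uK x) (fun x => u x - uK x) ≤
      energyForm Γ a (fun x => u x - v x) (fun x => u x - v x) := by
  have hv' := (hv.memH10 hΓ hΓb hK).1
  have hK' := (huK.1.memH10 hΓ hΓb hK).1
  -- Orthogonality to v and to uK yields the Pythagorean identity a(u - v, u - v) = a(u - uK, u -
  -- uK) + a(uK - v, uK - v), whose last term is nonnegative.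
  have h1 := hu.energyForm_sub_galerkin_eq_zero hΓ hΓb ha hK huK hv
  have h2 := hu.energyForm_sub_galerkin_eq_zero hΓ hΓb ha hK huK huK.1
  have h3 := energyForm_self_nonneg (u := fun x => uK x - v x) ha
  have hu' := hu.1.1
  rw [energyForm_sub_left hΓ ha hu' hK' hv'] at h1
  rw [energyForm_sub_left hΓ ha hu' hK' hK'] at h2
  rw [energyForm_sub_left hΓ ha hK' hv' (hK'.sub hΓ hv'), energyForm_sub_right hΓ ha hK' hv' hK',
    energyForm_sub_right hΓ ha hK' hv' hv', energyForm_comm (u := v) (v := uK)] at h3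
  rw [energyForm_sub_left hΓ ha hu' hK' (hu'.sub hΓ hK'), energyForm_sub_right hΓ ha hu' hK' hu',
    energyForm_sub_right hΓ ha hu' hK' hK', energyForm_sub_left hΓ ha hu' hv' (hu'.sub hΓ hv'),
    energyForm_sub_right hΓ ha hu' hv' hu', energyForm_sub_right hΓ ha hu' hv' hv',
    energyForm_comm (u := uK) (v := u), energyForm_comm (u := v) (v := u)]
  linarith

theorem IsMeshFamily.div_two_pow_mem (hT : IsMeshFamily Γ M T) {h : ℝ} (hM : h ∈ M) (n : ℕ) :
    h / 2 ^ n ∈ M := by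
  induction n with
  | zero => simpa using hM
  | succ n ih => simpa [pow_succ, div_div] using hT.half _ ih

theorem tendsto_div_two_pow (h : ℝ) : Tendsto (fun n : ℕ => h / 2 ^ n) atTop (𝓝 0) := by
  have := (tendsto_pow_atTop_nhds_zero_of_lt_one (r := (1 / 2 : ℝ)) (by norm_num)
    (by norm_num)).const_mul h
  simpa [div_eq_mul_inv] using this

theorem IsWeakSolution.tendsto_energyForm_sub_galerkin (hd : 1 ≤ d) (hΓ : IsOpen Γ)
    (hΓb : Bornology.IsBounded Γ) (ha : IsConductivity Γ a) (hT : IsMeshFamily Γ M T)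
    (hu : IsWeakSolution Γ a f u) {uh : ℝ → Space d → ℝ}
    (huh : ∀ h ∈ M, IsGalerkinSolution Γ (T h) a f (uh h)) {h : ℝ} (hM : h ∈ M) :
    Tendsto (fun n : ℕ => energyForm Γ a (fun x => u x - uh (h / 2 ^ n) x)
      (fun x => u x - uh (h / 2 ^ n) x)) atTop (𝓝 0) := by
  obtain ⟨B, hB, hab⟩ := ha.exists_nonneg_bound
  rw [Metric.tendsto_atTop]
  intro ε hε
  -- With η ≤ 1 and η(B + 1) ≤ ε, one has B η² ≤ B η < ε.
  set η : ℝ := min 1 (ε / (B + 1)) with hη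
  have hη0 : 0 < η := by positivity
  have hηε : B * η ^ 2 < ε := by
    have h1 : η ≤ 1 := min_le_left _ _
    have h2 : η * (B + 1) ≤ ε := (le_div_iff₀ (by positivity)).1 (min_le_right _ _)
    nlinarith [mul_nonneg (mul_nonneg hB hη0.le) (sub_nonneg.2 h1)]
  obtain ⟨h₁, hh₁, hex⟩ := hT.exists_memFE_eLpNorm_weakGrad_le hd hΓ hΓb hu.1
    (ENNReal.ofReal_pos.2 hη0)
  obtain ⟨N, hN⟩ := eventually_atTop.1 ((tendsto_div_two_pow h).eventually (gt_mem_nhds hh₁))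
  refine ⟨N, fun n hn => ?_⟩
  have hMn := hT.div_two_pow_mem hM n
  obtain ⟨v, hv, hle⟩ := hex _ hMn (hN n hn).le
  have hfin := (hT.mesh _ hMn).finite
  rw [Real.dist_eq, sub_zero, abs_of_nonneg (energyForm_self_nonneg ha)]
  refine (hu.energyForm_sub_galerkin_le hΓ hΓb ha hfin (huh _ hMn) hv).trans_lt ?_
  refine (energyForm_self_le ha hab (hu.1.1.sub hΓ (hv.memH10 hΓ hΓb hfin).1)).trans_lt
    (lt_of_le_of_lt ?_ hηε)
  have := ENNReal.toReal_le_of_le_ofReal hη0.le hle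
  gcongr

end Galerkin

/-! ### Summation over scales and the pathwise bound -/

theorem sum_range_pow_le_inv_one_sub {r : ℝ} (h0 : 0 ≤ r) (h1 : r < 1) (n : ℕ) :
    ∑ k ∈ Finset.range n, r ^ k ≤ (1 - r)⁻¹ := by
  rw [← tsum_geometric_of_lt_one h0 h1]
  exact (summable_geometric_of_lt_one h0 h1).sum_le_tsum _ fun k _ => pow_nonneg h0 k

theorem div_two_pow_rpow {h : ℝ} (hh : 0 < h) (α : ℝ) (k : ℕ) :
    (h / 2 ^ k) ^ α = h ^ α * ((2 : ℝ) ^ (-α)) ^ k := by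
  rw [Real.div_rpow hh.le (by positivity), Real.rpow_neg (by norm_num), inv_pow, div_eq_mul_inv,
    ← Real.rpow_natCast, ← Real.rpow_mul (by norm_num), ← Real.rpow_natCast,
    ← Real.rpow_mul (by norm_num), mul_comm (k : ℝ)]

/-- The bound on the Galerkin error for one path of the random data. -/
theorem abs_galerkinError_le (hd : 1 ≤ d) (hΓ : IsOpen Γ) (hΓb : Bornology.IsBounded Γ)
    {a f g : Space d → ℝ} (ha : IsConductivity Γ a) {M : Set ℝ}
    {T : ℝ → Geometry.SimplicialComplex ℝ (Space d)} (hT : IsMeshFamily Γ M T)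
    {u lam : Space d → ℝ} {uh lamh : ℝ → Space d → ℝ}
    (hu : IsWeakSolution Γ a f u) (hlam : IsWeakSolution Γ a g lam)
    (huh : ∀ h ∈ M, IsGalerkinSolution Γ (T h) a f (uh h))
    (hlamh : ∀ h ∈ M, IsGalerkinSolution Γ (T h) a g (lamh h))
    {α β C h₀ : ℝ} (hα : 0 < α) (hβ : 0 < β) (hC : 0 < C)
    (hscale : ∀ h ∈ M, ∀ H ∈ M, h ≤ h₀ → H ≤ h₀ →
      scaleIntegral Γ a (uh (h / 2)) (uh h) (lamh (H / 2)) (lamh H) ≤ C * h ^ α * H ^ β)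
    {h : ℝ} (hM : h ∈ M) (hh : h ≤ h₀) :
    |galerkinError Γ g u (uh h)| ≤
      C * h ^ (α + β) / ((1 - (2 : ℝ) ^ (-α)) * (1 - (2 : ℝ) ^ (-β))) := by
  have hpos := hT.pos h hM
  have hMn := hT.div_two_pow_mem hM
  have hle : ∀ n : ℕ, h / 2 ^ n ≤ h₀ := fun n =>
    (div_le_self hpos.le (one_le_pow₀ (by norm_num))).trans hh
  have hfin := fun n => (hT.mesh _ (hMn n)).finite
  set U : ℕ → Space d → ℝ := fun n => uh (h / 2 ^ n) with hUdef
  set V : ℕ → Space d → ℝ := fun n => lamh (h / 2 ^ n) with hVdef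
  have hU0 : uh h = U 0 := by simp [hUdef]
  have hU : ∀ n, MemH10 Γ (U n) := fun n => (huh _ (hMn n)).1.memH10 hΓ hΓb (hfin n)
  have hV : ∀ n, MemH10 Γ (V n) := fun n => (hlamh _ (hMn n)).1.memH10 hΓ hΓb (hfin n)
  have hu1 := hu.1.1
  have hl1 := hlam.1.1
  have herr : galerkinError Γ g u (uh h) =
      energyForm Γ a (fun x => u x - U 0 x) (fun x => lam x - V 0 x) := by
    rw [hU0, energyForm_sub_right hΓ ha hl1 (hV 0).1 (hu1.sub hΓ (hU 0).1),
      hu.energyForm_sub_galerkin_eq_zero hΓ hΓb ha (hfin 0) (huh _ (hMn 0)) (hlamh _ (hMn 0)).1,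
      sub_zero, energyForm_comm, hlam.2 _ (hu.1.sub hΓ (hU 0))]
    rfl
  have hbound : ∀ n, |energyForm Γ a (fun x => U n x - U 0 x) (fun x => V n x - V 0 x)| ≤
      C * h ^ (α + β) / ((1 - (2 : ℝ) ^ (-α)) * (1 - (2 : ℝ) ^ (-β))) := by
    intro n
    -- Bilinearity lets the two arguments telescope independently.
    have hsum : energyForm Γ a (fun x => U n x - U 0 x) (fun x => V n x - V 0 x) =
        ∑ k ∈ Finset.range n, ∑ l ∈ Finset.range n,
          energyForm Γ a (fun x => U (k + 1) x - U k x) (fun x => V (l + 1) x - V l x) := by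
      rw [energyForm_sub_left hΓ ha (hU n).1 (hU 0).1 ((hV n).1.sub hΓ (hV 0).1),
        ← Finset.sum_range_sub fun k => energyForm Γ a (U k) fun x => V n x - V 0 x]
      refine Finset.sum_congr rfl fun k _ => ?_
      have hUk := (hU (k + 1)).1.sub hΓ (hU k).1
      rw [← energyForm_sub_left hΓ ha (hU _).1 (hU k).1 ((hV n).1.sub hΓ (hV 0).1),
        energyForm_sub_right hΓ ha (hV n).1 (hV 0).1 hUk,
        ← Finset.sum_range_sub fun l => energyForm Γ a (fun x => U (k + 1) x - U k x) (V l)]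
      exact Finset.sum_congr rfl fun l _ =>
        (energyForm_sub_right hΓ ha (hV _).1 (hV l).1 hUk).symm
    have hterm : ∀ k l, |energyForm Γ a (fun x => U (k + 1) x - U k x)
        (fun x => V (l + 1) x - V l x)| ≤
        C * h ^ (α + β) * (((2 : ℝ) ^ (-α)) ^ k * ((2 : ℝ) ^ (-β)) ^ l) := by
      intro k l
      refine (abs_energyForm_sub_le_scaleIntegral ha).trans ?_
      have := hscale _ (hMn k) _ (hMn l) (hle k) (hle l)
      rw [div_div, div_div, ← pow_succ, ← pow_succ] at this
      refine this.trans (le_of_eq ?_)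
      rw [div_two_pow_rpow hpos, div_two_pow_rpow hpos, Real.rpow_add hpos]
      ring
    have hr : ∀ γ : ℝ, 0 < γ → (2 : ℝ) ^ (-γ) < 1 := fun γ hγ =>
      Real.rpow_lt_one_of_one_lt_of_neg (by norm_num) (by linarith)
    have hr0 : ∀ γ : ℝ, 0 ≤ (2 : ℝ) ^ (-γ) := fun γ => by positivity
    rw [hsum]
    calc |∑ k ∈ Finset.range n, ∑ l ∈ Finset.range n, energyForm Γ a
          (fun x => U (k + 1) x - U k x) (fun x => V (l + 1) x - V l x)|
        ≤ ∑ k ∈ Finset.range n, ∑ l ∈ Finset.range n,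
            C * h ^ (α + β) * (((2 : ℝ) ^ (-α)) ^ k * ((2 : ℝ) ^ (-β)) ^ l) :=
          (Finset.abs_sum_le_sum_abs _ _).trans (Finset.sum_le_sum fun k _ =>
            (Finset.abs_sum_le_sum_abs _ _).trans (Finset.sum_le_sum fun l _ => hterm k l))
      _ = C * h ^ (α + β) * ((∑ k ∈ Finset.range n, ((2 : ℝ) ^ (-α)) ^ k) *
            ∑ l ∈ Finset.range n, ((2 : ℝ) ^ (-β)) ^ l) := by
          rw [Finset.sum_mul_sum, Finset.mul_sum]
          simp_rw [Finset.mul_sum]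
      _ ≤ C * h ^ (α + β) * ((1 - (2 : ℝ) ^ (-α))⁻¹ * (1 - (2 : ℝ) ^ (-β))⁻¹) := by
          refine mul_le_mul_of_nonneg_left ?_ (by positivity)
          refine mul_le_mul (sum_range_pow_le_inv_one_sub (hr0 α) (hr α hα) n)
            (sum_range_pow_le_inv_one_sub (hr0 β) (hr β hβ) n)
            (Finset.sum_nonneg fun l _ => pow_nonneg (hr0 β) l)
            (inv_nonneg.2 (sub_nonneg.2 (hr α hα).le))
      _ = _ := by rw [← mul_inv, div_eq_mul_inv]
  have hsubU : ∀ n, MemH1 Γ (fun x => u x - U n x) := fun n => hu1.sub hΓ (hU n).1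
  have hsubV : ∀ n, MemH1 Γ (fun x => lam x - V n x) := fun n => hl1.sub hΓ (hV n).1
  have hQU := hu.tendsto_energyForm_sub_galerkin hd hΓ hΓb ha hT huh hM
  have hQV := hlam.tendsto_energyForm_sub_galerkin hd hΓ hΓb ha hT hlamh hM
  have t1 := tendsto_energyForm_zero ha hsubU (fun _ => hsubV 0) hQU tendsto_const_nhds
  have t2 := tendsto_energyForm_zero ha hsubV (fun _ => hsubU 0) hQV tendsto_const_nhds
  have t3 := tendsto_energyForm_zero ha hsubU hsubV hQU hQV
  -- With errors e_n = u - U_n and ε_n = λ - V_n, the form a(e_0 - e_n, ε_0 - ε_n) expands into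
  -- a(e_0, ε_0) and three terms that vanish in the limit by Cauchy–Schwarz.
  have hlim : Tendsto (fun n => energyForm Γ a (fun x => U n x - U 0 x)
      (fun x => V n x - V 0 x)) atTop
      (𝓝 (energyForm Γ a (fun x => u x - U 0 x) (fun x => lam x - V 0 x))) := by
    have h1 := ((tendsto_const_nhds (x := energyForm Γ a (fun x => u x - U 0 x)
      (fun x => lam x - V 0 x))).sub t1).sub t2 |>.add t3
    rw [sub_zero, sub_zero, add_zero] at h1
    refine h1.congr fun n => ?_
    rw [energyForm_comm (u := fun x => lam x - V n x)]
    have e1 : ∀ w, MemH1 Γ w → ∀ m, energyForm Γ a (fun x => u x - U m x) w =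
        energyForm Γ a u w - energyForm Γ a (U m) w := fun w hw m =>
      energyForm_sub_left hΓ ha hu1 (hU m).1 hw
    have e2 : ∀ w, MemH1 Γ w → ∀ m, energyForm Γ a w (fun x => lam x - V m x) =
        energyForm Γ a w lam - energyForm Γ a w (V m) := fun w hw m =>
      energyForm_sub_right hΓ ha hl1 (hV m).1 hw
    rw [e1 _ (hsubV 0), e1 _ (hsubV 0), e1 _ (hsubV n), e1 _ (hsubV n),
      energyForm_sub_left hΓ ha (hU n).1 (hU 0).1 ((hV n).1.sub hΓ (hV 0).1),
      energyForm_sub_right hΓ ha (hV n).1 (hV 0).1 (hU n).1,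
      energyForm_sub_right hΓ ha (hV n).1 (hV 0).1 (hU 0).1,
      e2 _ hu1, e2 _ hu1, e2 _ (hU 0).1, e2 _ (hU 0).1, e2 _ (hU n).1, e2 _ (hU n).1]
    ring
  rw [herr]
  exact le_of_tendsto hlim.abs (Eventually.of_forall hbound)

end

theorem mainTheorem1 {Ω : Type*} [MeasurableSpace Ω] (P : Measure Ω) [IsProbabilityMeasure P]
    {d : ℕ} (hd : 1 ≤ d) (Γ : Set (Space d)) (hΓ : IsOpen Γ) (hΓb : Bornology.IsBounded Γ)
    -- the random conductivity and source, and the observable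
    (a f : Ω → Space d → ℝ) (g : Space d → ℝ)
    (ha : ∀ᵐ ω ∂P, IsConductivity Γ (a ω))
    (hf : ∀ᵐ ω ∂P, IsSource Γ (f ω)) (hg : IsSource Γ g)
    -- the meshes, and the exact and discrete, primal and dual solutions
    (M : Set ℝ) (T : ℝ → Geometry.SimplicialComplex ℝ (Space d)) (hT : IsMeshFamily Γ M T)
    (u lam : Ω → Space d → ℝ) (uh lamh : Ω → ℝ → Space d → ℝ)
    (hu : ∀ᵐ ω ∂P, IsWeakSolution Γ (a ω) (f ω) (u ω))
    (hlam : ∀ᵐ ω ∂P, IsWeakSolution Γ (a ω) g (lam ω))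
    (huh : ∀ᵐ ω ∂P, ∀ h ∈ M, IsGalerkinSolution Γ (T h) (a ω) (f ω) (uh ω h))
    (hlamh : ∀ᵐ ω ∂P, ∀ h ∈ M, IsGalerkinSolution Γ (T h) (a ω) g (lamh ω h))
    -- the assumption on scales, for mesh sizes up to `h₀ ω`
    (α β : ℝ) (hα : 0 < α) (hβ : 0 < β)
    (C : Ω → ℝ) (hC : Measurable C) (hCpos : ∀ᵐ ω ∂P, 0 < C ω)
    (h₀ : Ω → ℝ) (hh₀ : ∀ᵐ ω ∂P, 0 < h₀ ω)
    (hscale : ∀ᵐ ω ∂P, ∀ h ∈ M, ∀ H ∈ M, h ≤ h₀ ω → H ≤ h₀ ω →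
      scaleIntegral Γ (a ω) (uh ω (h / 2)) (uh ω h) (lamh ω (H / 2)) (lamh ω H) ≤
        C ω * h ^ α * H ^ β) :
    ∀ᵐ ω ∂P, ∀ h ∈ M, h ≤ h₀ ω →
      |galerkinError Γ g (u ω) (uh ω h)| ≤
        C ω * h ^ (α + β) / ((1 - (2 : ℝ) ^ (-α)) * (1 - (2 : ℝ) ^ (-β))) := by
  filter_upwards [ha, hu, hlam, huh, hlamh, hCpos, hscale] with ω ha hu hlam huh hlamh hC hscale
  intro h hM hh
  exact abs_galerkinError_le hd hΓ hΓb ha hT hu hlam huh hlamh hα hβ hC hscale hM hh
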